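/- Let $0<\alpha<2$, let $K\subset\mathbb{R}_+$ be compact, and let $E_K$ be the Banach space of real continuous functions on $K$ with the uniform norm $\|\cdot\|$ and dual $E_K'$. On one probability space let $(\Gamma_n)_{n\ge1}$ be the arrival times of a rate-$1$ Poisson process on $\mathbb{R}_+$, let $(G_n)_{n\ge1}$ be i.i.d. standard normal variables, let $(X_n)_{n\ge1}$ be i.i.d. real variables whose law has a positive density $\phi$ with respect to Lebesgue measure, and let $(f_n)_{n\ge1}$ be i.i.d. non-negative random continuous functions $f_n:\mathbb{R}\times\mathbb{R}_+\to\mathbb{R}$; the four sequences are mutually independent. Assume that for every $p>0$, $\sup_{x\in\mathbb{R}}\mathbb{E}\,[\|f_n(x,\cdot)\|^p]<\infty$, and that there are $\rho\ge0$, $H\in(0,1)$ and, for each $n$, a fractional Brownian motion $B^{H,n}$ of Hurst parameter $H$ on the same probability space such that almost surely, for all $t\ge0$, $f_n(\cdot,t)$ vanishes outside $\big[\inf_{s\le t}B^{H,n}_s-\rho,\ \sup_{s\le t}B^{H,n}_s+\rho\big]$. Put $V_n=G_n\,\phi(X_n)^{-1/\alpha}f_n(X_n,\cdot)\in E_K$,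 let $\lambda$ be the law of $V_n$ on $E_K$, let $h(r,v)=r^{-1/\alpha}v$ for $r>0$, $v\in E_K$, and let $Y_\phi(t)=\sum_{n\ge1}\Gamma_n^{-1/\alpha}G_n\,\phi(X_n)^{-1/\alpha}f_n(X_n,t)=\sum_{n\ge 1}h(\Gamma_n,V_n)(t)$ for $t\in K$. Then for every $y'\in E_K'$ the integral below converges absolutely, and $$\mathbb{E}\left[e^{i\langle y',Y_\phi\rangle}\right]=\exp\int_{(0,\infty)\times E_K}\left(e^{i\langle y',h(r,v)\rangle}-1-i\langle y',h(r,v)\rangle\mathbf{1}_{\|h(r,v)\|\le1}\right)dr\,\lambda(dv).$$ This holds in both of the following senses: (a) for every random element $Y_\phi$ of $E_K$ such that, for each $t\in K$, almost surely $Y_\phi(t)=\sum_{n\ge1}h(\Gamma_n,V_n)(t)$; (b) with $\langle y',Y_\phi\rangle$ read as $\sum_{n\ge1}\langle y',h(\Gamma_n,V_n)\rangle$; this series of real random variables converges almost surely. -/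

import Mathlib

open MeasureTheory ProbabilityTheory Filter Topology TopologicalSpace
open scoped NNReal ENNReal

noncomputable section

/-- `Γ 0 < Γ 1 < ⋯` are the successive arrival times of a Poisson process of rate `1` on `[0, ∞)`:
the waiting times are i.i.d. exponential variables of parameter `1`. -/
def IsUnitPoissonArrivalTimes {Ω : Type*} [MeasurableSpace Ω] (Γ : ℕ → Ω → ℝ)
    (P : Measure Ω) : Prop :=
  ∃ ξ : ℕ → Ω → ℝ, (∀ n, Measurable (ξ n)) ∧ (∀ n, P.map (ξ n) = expMeasure 1) ∧
    iIndepFun ξ P ∧ ∀ n ω, Γ n ω = ∑ i ∈ Finset.range (n + 1), ξ i ω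

/-- `B` is a (standard) fractional Brownian motion with Hurst parameter `H ∈ (0, 1)`, indexed
by `[0, ∞)`, with almost surely continuous paths. -/
structure IsFractionalBrownianMotion {Ω : Type*} [MeasurableSpace Ω] (H : ℝ)
    (B : ℝ≥0 → Ω → ℝ) (P : Measure Ω) : Prop where
  hurst_pos : 0 < H
  hurst_lt_one : H < 1
  isGaussianProcess : IsGaussianProcess B P
  centered : ∀ t, ∫ ω, B t ω ∂P = 0
  covariance_eq : ∀ s t : ℝ≥0, cov[B s, B t; P] =
    ((s : ℝ) ^ (2 * H) + (t : ℝ) ^ (2 * H) - |(t : ℝ) - (s : ℝ)| ^ (2 * H)) / 2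
  continuous_paths : ∀ᵐ ω ∂P, Continuous fun t => B t ω

/-- The interval `[inf_{s ≤ t} b s - ρ, sup_{s ≤ t} b s + ρ]`. -/
def enlargedRange (b : ℝ≥0 → ℝ) (ρ : ℝ) (t : ℝ≥0) : Set ℝ :=
  Set.Icc (sInf (b '' Set.Iic t) - ρ) (sSup (b '' Set.Iic t) + ρ)

/-- The section `t ↦ f (x, t)`, as a continuous function on the compact set `K ⊆ [0, ∞)`. -/
def sectionOn (K : Compacts ℝ≥0) (f : C(ℝ × ℝ≥0, ℝ)) (x : ℝ) : C(K, ℝ) where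
  toFun t := f (x, (t : ℝ≥0))
  continuous_toFun := by fun_prop

/-- `h (r, v) = r ^ (-1/α) v`. -/
def shotKernel {E : Type*} [SMul ℝ E] (α : ℝ) (r : ℝ) (v : E) : E :=
  r ^ (-1 / α) • v

/-- The random functions `V n = G n * φ (X n) ^ (-1/α) * f n (X n, ·)`, as elements of `C(K)`. -/
def shotMark {Ω : Type*} (K : Compacts ℝ≥0) (α : ℝ) (φ : ℝ → ℝ) (G X : ℕ → Ω → ℝ)
    (f : ℕ → Ω → C(ℝ × ℝ≥0, ℝ)) (n : ℕ) (ω : Ω) : C(K, ℝ) :=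
  (G n ω * φ (X n ω) ^ (-1 / α)) • sectionOn K (f n ω) (X n ω)

/-- The partial sum `∑_{n < N} h (Γ n, V n)`. -/
def shotPartialSum {Ω E : Type*} [AddCommMonoid E] [SMul ℝ E] (α : ℝ) (Γ : ℕ → Ω → ℝ)
    (V : ℕ → Ω → E) (N : ℕ) (ω : Ω) : E :=
  ∑ n ∈ Finset.range N, shotKernel α (Γ n ω) (V n ω)

/-- `Y` is a random element of `C(K)` realizing the series `∑ h (Γ n, V n)`: for every `t ∈ K`,
almost surely, `Y t` is the sum of the series of the values at `t`. -/
structure IsShotSeries {Ω : Type*} [MeasurableSpace Ω] {K : Compacts ℝ≥0}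
    [MeasurableSpace C(K, ℝ)] (α : ℝ) (Γ : ℕ → Ω → ℝ) (V : ℕ → Ω → C(K, ℝ))
    (Y : Ω → C(K, ℝ)) (P : Measure Ω) : Prop where
  aemeasurable : AEMeasurable Y P
  tendsto : ∀ t : K, ∀ᵐ ω ∂P,
    Tendsto (fun N => shotPartialSum α Γ V N ω t) atTop (𝓝 (Y ω t))

/-- The Lévy–Khintchine integrand `e^{i⟨y', y⟩} - 1 - i⟨y', y⟩ 1_{‖y‖ ≤ 1}`. -/
def levyKhintchineIntegrand {E : Type*} [NormedAddCommGroup E] [NormedSpace ℝ E]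
    (y' : StrongDual ℝ E) (y : E) : ℂ :=
  Complex.exp (Complex.I * (y' y : ℂ)) - 1 -
    Set.indicator {z : E | ‖z‖ ≤ 1} (fun z => Complex.I * (y' z : ℂ)) y

end

/-! Let S_N be the N-th partial sum and g(r) = E exp(i⟨y', h(r, V 0)⟩). Given the arrival times, the
marks are i.i.d., so E exp(i⟨y', S_N⟩) is the expectation of the product of g over the first N
arrival times (`IsSymmetricShot.integral_exp_eq`). With A(s) = exp(-∫_s^∞ (1 - g)), the product
multiplied by A at the last arrival time has the constant expectation A(0)
(`integral_expTail_mul_prod`). Arrival times tend to infinity and A tends to 1, so the limit is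
exp(-∫_0^∞ (1 - g)). The marks are symmetric because of the Gaussian factor; hence the compensator
has mean zero for each fixed r, and -∫(1 - g) is the Lévy–Khintchine exponent.

All integrability rests on E‖V‖^α < ∞: the integrand is at most a constant times min(1, ‖h‖²), whose
integral in r is at most a constant times ‖v‖^α since 2/α > 1. In E‖V‖^α the factor 1/φ cancels the
density of X, leaving ∫ E‖f(x, ·)‖^α dx. This is finite because f(x, ·) vanishes for x outside a
random interval whose size has a fourth moment, by Fernique's theorem.

For reading (b), truncation and martingale convergence give almost sure convergence. For reading
(a), Y is only a pointwise limit, and convergence in probability in the uniform norm is needed.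
Changing the sign of all marks from index N on shows that 2S_N - Y has the law of Y. Thus S_N - Y,
half the difference of two variables with one tight law, lies with high probability in a fixed
compact set, where finitely many evaluations control the norm
(`IsSymmetricShot.tendsto_measure_norm_sub`). -/

/-! ### Borel structure of spaces of continuous functions -/

/-- On `C(X, ℝ)` with `X` compact, restriction to a countable dense set is a Borel embedding. -/
theorem ContinuousMap.measurableEmbedding_restrict {X : Type*} [TopologicalSpace X]
    [CompactSpace X] [SecondCountableTopology X] [T2Space X]
    [MeasurableSpace C(X, ℝ)] [BorelSpace C(X, ℝ)]
    {D : Set X} (hc : D.Countable) (hd : Dense D) :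
    MeasurableEmbedding (fun (f : C(X, ℝ)) (d : D) => f d) := by
  have : Countable D := hc
  refine Continuous.measurableEmbedding (by fun_prop) fun f g h => ?_
  exact DFunLike.coe_injective
    (Continuous.ext_on hd f.continuous g.continuous fun x hx => congrFun h ⟨x, hx⟩)

theorem ContinuousMap.measurable_of_eval {Ω X : Type*} [MeasurableSpace Ω] [TopologicalSpace X]
    [CompactSpace X] [SecondCountableTopology X] [T2Space X]
    [MeasurableSpace C(X, ℝ)] [BorelSpace C(X, ℝ)]
    {F : Ω → C(X, ℝ)} (h : ∀ x, Measurable fun ω => F ω x) : Measurable F := by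
  obtain ⟨D, hc, hd⟩ := TopologicalSpace.exists_countable_dense X
  rw [← (measurableEmbedding_restrict hc hd).measurable_comp_iff]
  exact measurable_pi_lambda _ fun d => h d

theorem ContinuousMap.aemeasurable_of_eval {Ω X : Type*} [MeasurableSpace Ω] {P : Measure Ω}
    [TopologicalSpace X] [CompactSpace X] [SecondCountableTopology X] [T2Space X]
    [MeasurableSpace C(X, ℝ)] [BorelSpace C(X, ℝ)]
    {F : Ω → C(X, ℝ)} (h : ∀ x, AEMeasurable (fun ω => F ω x) P) : AEMeasurable F P := by
  obtain ⟨D, hc, hd⟩ := TopologicalSpace.exists_countable_dense X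
  have : Countable D := hc
  have hF : AEMeasurable ((fun (f : C(X, ℝ)) (d : D) => f d) ∘ F) P :=
    aemeasurable_pi_lambda _ fun d => h d
  exact (measurableEmbedding_restrict hc hd).aemeasurable_comp_iff.1 hF

/-! ### Moments of suprema of Gaussian processes -/

/-- Two finite measures on `(ι → ℝ) × (ι → ℝ)` with the same finite-dimensional marginals
coincide. -/
theorem MeasureTheory.Measure.ext_of_map_prodMap_restrict {ι : Type*}
    {M N : Measure ((ι → ℝ) × (ι → ℝ))} [IsFiniteMeasure M] [IsFiniteMeasure N]
    (h : ∀ I : Finset ι,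
      M.map (Prod.map (I.restrict (π := fun _ => ℝ)) (I.restrict (π := fun _ => ℝ))) =
      N.map (Prod.map (I.restrict (π := fun _ => ℝ)) (I.restrict (π := fun _ => ℝ)))) : M = N := by
  -- Pairs of functions become functions with values in ℝ × ℝ, so uniqueness of projective limits
  -- applies.
  let e := (MeasurableEquiv.arrowProdEquivProdArrow ℝ ℝ ι).symm
  refine e.measurableEmbedding.map_injective ?_
  refine IsProjectiveLimit.unique (P := fun I => (N.map e).map I.restrict) (fun I => ?_)
    (fun I => rfl)
  have key : ∀ Q : Measure ((ι → ℝ) × (ι → ℝ)), (Q.map e).map I.restrict =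
      (Q.map (Prod.map (I.restrict (π := fun _ => ℝ)) (I.restrict (π := fun _ => ℝ)))).map
        (MeasurableEquiv.arrowProdEquivProdArrow ℝ ℝ I).symm := by
    intro Q
    rw [Measure.map_map (by fun_prop) e.measurable,
      Measure.map_map (MeasurableEquiv.measurable _) (by fun_prop)]
    rfl
  exact (key M).trans ((congrArg _ (h I)).trans (key N).symm)

/-- The law of a centered Gaussian process is such that its square is invariant under rotation. -/
theorem ProbabilityTheory.IsGaussianProcess.map_rotation_eq_self {Ω ι : Type*} [MeasurableSpace Ω]
    {P : Measure Ω} {B : ι → Ω → ℝ} (hB : IsGaussianProcess B P)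
    (hm : AEMeasurable (fun ω i => B i ω) P)
    (h0 : ∀ i, ∫ ω, B i ω ∂P = 0) (θ : ℝ) :
    ((P.map fun ω i => B i ω).prod (P.map fun ω i => B i ω)).map
      (fun p => ((fun i => Real.cos θ * p.1 i + Real.sin θ * p.2 i),
        (fun i => - Real.sin θ * p.1 i + Real.cos θ * p.2 i))) =
    (P.map fun ω i => B i ω).prod (P.map fun ω i => B i ω) := by
  have := hB.isProbabilityMeasure
  have : IsProbabilityMeasure (P.map fun ω i => B i ω) := Measure.isProbabilityMeasure_map hm
  set m := P.map fun ω i => B i ω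
  have hR : Measurable (fun p : (ι → ℝ) × (ι → ℝ) =>
      ((fun i => Real.cos θ * p.1 i + Real.sin θ * p.2 i),
        (fun i => - Real.sin θ * p.1 i + Real.cos θ * p.2 i))) := by fun_prop
  refine Measure.ext_of_map_prodMap_restrict fun I => ?_
  have hG := hB.hasGaussianLaw I
  have hI : m.map I.restrict = P.map fun ω => I.restrict (B · ω) := by
    rw [AEMeasurable.map_map_of_aemeasurable (by fun_prop) hm]
    rfl
  have hg : IsGaussian (m.map I.restrict) := by rw [hI]; exact hG.isGaussian_map
  have hz : ∀ L : StrongDual ℝ (I → ℝ), (m.map I.restrict)[L] = 0 := by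
    intro L
    have hid : Integrable (fun x => x) (m.map I.restrict) := IsGaussian.integrable_id
    rw [L.integral_comp_comm hid]
    have : ∫ x, x ∂(m.map I.restrict) = 0 := by
      ext i
      have hp := (ContinuousLinearMap.proj (R := ℝ) (φ := fun _ : I => ℝ) i).integral_comp_comm hid
      refine hp.symm.trans ?_
      rw [hI, integral_map hG.aemeasurable (by fun_prop)]
      exact h0 i
    rw [this, map_zero]
  have hrot := IsGaussian.map_rotation_eq_self_of_forall_strongDual_eq_zero hz θ
  have hprod : (m.prod m).map
      (Prod.map (I.restrict (π := fun _ => ℝ)) (I.restrict (π := fun _ => ℝ))) =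
      (m.map I.restrict).prod (m.map I.restrict) :=
    (Measure.map_prod_map _ _ (by fun_prop) (by fun_prop)).symm
  rw [hprod, ← hrot, ← hprod, Measure.map_map (by fun_prop) hR,
    Measure.map_map (by fun_prop) (by fun_prop)]
  congr 1

/-- The supremum of a centered Gaussian process with almost surely continuous paths, over a
bounded time interval, has a finite fourth moment. -/
theorem ProbabilityTheory.IsGaussianProcess.exists_integrable_sup_pow_four {Ω : Type*}
    [MeasurableSpace Ω] {P : Measure Ω} {B : ℝ≥0 → Ω → ℝ} (hB : IsGaussianProcess B P)
    (h0 : ∀ t, ∫ ω, B t ω ∂P = 0) (hc : ∀ᵐ ω ∂P, Continuous fun t => B t ω) (T : ℝ≥0) :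
    ∃ S : Ω → ℝ, (∀ ω, 0 ≤ S ω) ∧ Integrable (fun ω => S ω ^ 4) P ∧
      AEMeasurable S P ∧ ∀ᵐ ω ∂P, ∀ t ≤ T, |B t ω| ≤ S ω := by
  classical
  have := hB.isProbabilityMeasure
  let X := Set.Icc (0 : ℝ≥0) T
  let : MeasurableSpace C(X, ℝ) := borel _
  have : BorelSpace C(X, ℝ) := ⟨rfl⟩
  let path : Ω → C(X, ℝ) := fun ω =>
    if h : Continuous fun t => B t ω then ⟨fun t => B t ω, h.comp continuous_subtype_val⟩ else 0
  have hpath : ∀ᵐ ω ∂P, ∀ t : X, path ω t = B t ω := by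
    filter_upwards [hc] with ω h t
    simp only [path, dif_pos h]
    rfl
  have hpm : AEMeasurable path P := by
    refine ContinuousMap.aemeasurable_of_eval fun t => ?_
    exact (hB.aemeasurable t).congr (hpath.mono fun ω h => (h t).symm)
  set μ := P.map path with hμ
  have : IsProbabilityMeasure μ := Measure.isProbabilityMeasure_map hpm
  -- Invariance under this rotation is the hypothesis of Fernique's theorem. It is tested on a
  -- countable dense set of times, where the path law is that of a Gaussian process.
  have hrot : (μ.prod μ).map (ContinuousLinearMap.rotation (-(Real.pi / 4))) = μ.prod μ := by
    obtain ⟨D, hDc, hDd⟩ := TopologicalSpace.exists_countable_dense X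
    have : Countable D := hDc
    have hE := ContinuousMap.measurableEmbedding_restrict hDc hDd
    set E := fun (f : C(X, ℝ)) (d : D) => f d
    refine (hE.prodMap hE).map_injective ?_
    have hBD : IsGaussianProcess (fun d : D => B (d : X)) P :=
      hB.comp_right fun d : D => ((d : X) : ℝ≥0)
    have hBm : AEMeasurable (fun ω (d : D) => B (d : X) ω) P :=
      aemeasurable_pi_lambda _ fun d => hB.aemeasurable _
    have hmap : μ.map E = P.map fun ω (d : D) => B (d : X) ω := by
      rw [hμ, AEMeasurable.map_map_of_aemeasurable hE.measurable.aemeasurable hpm]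
      refine Measure.map_congr (hpath.mono fun ω h => ?_)
      ext d
      exact h d
    have hprod : (μ.prod μ).map (Prod.map E E) = (μ.map E).prod (μ.map E) :=
      (Measure.map_prod_map _ _ hE.measurable hE.measurable).symm
    have h := hBD.map_rotation_eq_self hBm (fun d => h0 _) (-(Real.pi / 4))
    rw [← hmap, ← hprod, Measure.map_map (by fun_prop) (hE.prodMap hE).measurable] at h
    rw [Measure.map_map (hE.prodMap hE).measurable (by fun_prop)]
    exact h
  obtain ⟨C, hC, hint⟩ := exists_integrable_exp_sq_of_map_rotation_eq_self hrot
  have hint4 : Integrable (fun x : C(X, ℝ) => ‖x‖ ^ 4) μ := by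
    refine (hint.const_mul (2 / C ^ 2)).mono' (by fun_prop) (ae_of_all _ fun x => ?_)
    have h := Real.quadratic_le_exp_of_nonneg (x := C * ‖x‖ ^ 2) (by positivity)
    have h2 : (C * ‖x‖ ^ 2) ^ 2 / 2 ≤ Real.exp (C * ‖x‖ ^ 2) := by
      have : 0 ≤ C * ‖x‖ ^ 2 := by positivity
      linarith
    calc ‖‖x‖ ^ 4‖ = 2 / C ^ 2 * ((C * ‖x‖ ^ 2) ^ 2 / 2) := by
          rw [Real.norm_of_nonneg (by positivity)]
          field_simp
      _ ≤ _ := by gcongr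
  refine ⟨fun ω => ‖path ω‖, fun ω => norm_nonneg _, ?_, ?_, ?_⟩
  · exact (integrable_map_measure hint4.aestronglyMeasurable hpm).1 hint4
  · exact measurable_norm.comp_aemeasurable hpm
  · filter_upwards [hpath] with ω h t ht
    rw [← h ⟨t, ⟨zero_le, ht⟩⟩]
    exact (path ω).norm_coe_le_norm _

/-! ### The exponential law of the waiting times -/

theorem integral_expMeasure_one {E : Type*} [NormedAddCommGroup E] [NormedSpace ℝ E] (f : ℝ → E) :
    ∫ u, f u ∂(expMeasure 1) = ∫ u in Set.Ioi 0, Real.exp (-u) • f u := by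
  have h : expMeasure 1 =
      (volume.restrict (Set.Ioi 0)).withDensity fun u => ENNReal.ofReal (Real.exp (-u)) := by
    rw [expMeasure, gammaMeasure, ← withDensity_indicator measurableSet_Ioi]
    refine withDensity_congr_ae ?_
    filter_upwards [compl_mem_ae_iff.2 (measure_singleton (0 : ℝ))] with u hu
    have hu' : u ≠ 0 := hu
    change exponentialPDF 1 u = _
    rw [exponentialPDF_eq, Set.indicator_apply]
    rcases lt_or_gt_of_ne hu' with h | h
    · simp [not_le.2 h, not_lt.2 h.le]
    · simp [h, h.le]
  rw [h, integral_withDensity_eq_integral_toReal_smul (by fun_prop) (by simp)]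
  simp [Real.exp_nonneg]

theorem expMeasure_one_ae_pos : ∀ᵐ u ∂(expMeasure 1), 0 < u := by
  have hm : Measurable (gammaPDF 1 1) := (measurable_exponentialPDFReal 1).ennreal_ofReal
  rw [expMeasure, gammaMeasure, ae_withDensity_iff hm]
  filter_upwards [compl_mem_ae_iff.2 (measure_singleton (0 : ℝ))] with u hu h
  by_contra h0
  exact h (gammaPDF_of_neg (lt_of_le_of_ne (not_lt.1 h0) hu))

/-- Otherwise the Bochner integral would take its default value 0, whereas it equals Γ(2) = 1. -/
theorem integrable_id_expMeasure_one : Integrable (fun u : ℝ => u) (expMeasure 1) := by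
  by_contra h
  have := integral_undef h
  rw [integral_expMeasure_one] at this
  have h2 := Real.Gamma_eq_integral (s := 2) (by norm_num)
  rw [Real.Gamma_two] at h2
  norm_num at h2
  simp only [smul_eq_mul] at this
  linarith

theorem integral_id_expMeasure_one : ∫ u : ℝ, u ∂(expMeasure 1) = 1 := by
  rw [integral_expMeasure_one]
  have h2 := Real.Gamma_eq_integral (s := 2) (by norm_num)
  rw [Real.Gamma_two] at h2
  norm_num at h2
  simpa using h2.symm

/-! ### The renewal equation for the tail exponential -/

section Renewal

variable {g : ℝ → ℂ}

/-- `exp (-∫ r in (s, ∞), (1 - g r))`, for `0 ≤ s`. -/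
noncomputable def expTail (g : ℝ → ℂ) (s : ℝ) : ℂ :=
  -- Written as a primitive minus the total integral, so that the fundamental theorem of calculus
  -- gives A' = A(1 - g). The indicator makes the integrand integrable on the whole line.
  Complex.exp ((∫ r in (0 : ℝ)..s, (Set.Ioi 0).indicator (fun r => 1 - g r) r) -
    ∫ r in Set.Ioi 0, (1 - g r))

theorem continuous_expTail (hint : IntegrableOn (fun r => 1 - g r) (Set.Ioi 0)) :
    Continuous (expTail g) := by
  have hk := (integrable_indicator_iff measurableSet_Ioi).2 hint
  have := intervalIntegral.continuous_primitive (fun a b => hk.intervalIntegrable) (0 : ℝ)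
  unfold expTail
  fun_prop

theorem expTail_zero : expTail g 0 = Complex.exp (-∫ r in Set.Ioi 0, (1 - g r)) := by
  simp [expTail]

theorem tendsto_expTail (hint : IntegrableOn (fun r => 1 - g r) (Set.Ioi 0)) :
    Tendsto (expTail g) atTop (𝓝 1) := by
  have hk := (integrable_indicator_iff measurableSet_Ioi).2 hint
  have h := intervalIntegral_tendsto_integral_Ioi (0 : ℝ) hk.integrableOn tendsto_id
  rw [setIntegral_indicator measurableSet_Ioi, Set.inter_self] at h
  have h2 := (Complex.continuous_exp.tendsto _).comp (h.sub_const (∫ r in Set.Ioi 0, (1 - g r)))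
  rw [sub_self, Complex.exp_zero] at h2
  exact h2

theorem exists_norm_expTail_le (hint : IntegrableOn (fun r => 1 - g r) (Set.Ioi 0)) :
    ∃ M, ∀ s, 0 ≤ s → ‖expTail g s‖ ≤ M := by
  have hk := (integrable_indicator_iff measurableSet_Ioi).2 hint
  refine ⟨Real.exp ((∫ r, ‖(Set.Ioi 0).indicator (fun r => 1 - g r) r‖) +
    ‖∫ r in Set.Ioi 0, (1 - g r)‖), fun s hs => ?_⟩
  rw [expTail, Complex.norm_exp]
  refine Real.exp_le_exp.2 ((Complex.re_le_norm _).trans ((norm_sub_le _ _).trans ?_))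
  gcongr
  rw [intervalIntegral.integral_of_le hs]
  exact (norm_integral_le_integral_norm _).trans
    (setIntegral_le_integral hk.norm (ae_of_all _ fun _ => norm_nonneg _))

theorem hasDerivAt_expTail (hc : ContinuousOn g (Set.Ioi 0))
    (hint : IntegrableOn (fun r => 1 - g r) (Set.Ioi 0)) {s : ℝ} (hs : 0 < s) :
    HasDerivAt (expTail g) (expTail g s * (1 - g s)) s := by
  have hk := (integrable_indicator_iff measurableSet_Ioi).2 hint
  have hnhds : Set.Ioi (0 : ℝ) ∈ 𝓝 s := Ioi_mem_nhds hs
  have heq : (Set.Ioi 0).indicator (fun r => 1 - g r) =ᶠ[𝓝 s] fun r => 1 - g r := by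
    filter_upwards [hnhds] with r hr
    exact Set.indicator_of_mem hr _
  have hcont : ContinuousAt ((Set.Ioi 0).indicator (fun r => 1 - g r)) s :=
    (continuousAt_const.sub (hc.continuousAt hnhds)).congr heq.symm
  have h := intervalIntegral.integral_hasDerivAt_right (hk.intervalIntegrable (a := 0) (b := s))
    (hk.aestronglyMeasurable.stronglyMeasurableAtFilter) hcont
  rw [heq.eq_of_nhds] at h
  exact (h.sub_const _).cexp

/-- Since A' = A(1 - g), the integrand against e^{-u} du is the derivative of -e^{-u} A(s + u). The
boundary terms are A(s) at 0 and 0 at infinity. -/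
theorem integral_expMeasure_expTail (hgm : Measurable g) (hc : ContinuousOn g (Set.Ioi 0))
    (hg1 : ∀ r, ‖g r‖ ≤ 1)
    (hint : IntegrableOn (fun r => 1 - g r) (Set.Ioi 0)) {s : ℝ} (hs : 0 ≤ s) :
    ∫ u, expTail g (s + u) * g (s + u) ∂(expMeasure 1) = expTail g s := by
  obtain ⟨M, hM⟩ := exists_norm_expTail_le hint
  have hA := continuous_expTail hint
  have hexp : IntegrableOn (fun u : ℝ => Real.exp (-u)) (Set.Ioi 0) := integrableOn_exp_neg_Ioi 0
  rw [integral_expMeasure_one]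
  have key := integral_Ioi_of_hasDerivAt_of_tendsto (a := (0 : ℝ)) (m := (0 : ℂ))
    (f := fun u => -(Real.exp (-u) • expTail g (s + u)))
    (f' := fun u => Real.exp (-u) • (expTail g (s + u) * g (s + u))) ?_ ?_ ?_ ?_
  · rw [key]; simp
  · fun_prop
  · intro u hu
    have hsu : 0 < s + u := add_pos_of_nonneg_of_pos hs hu
    have h1 : HasDerivAt (fun u : ℝ => expTail g (s + u))
        (expTail g (s + u) * (1 - g (s + u))) u := by
      have h := (hasDerivAt_expTail hc hint hsu).scomp u ((hasDerivAt_id u).const_add s)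
      rw [one_smul] at h
      exact h
    have h2 : HasDerivAt (fun u : ℝ => Real.exp (-u)) (-Real.exp (-u)) u := by
      simpa using (hasDerivAt_neg u).exp
    refine (h2.smul h1).neg.congr_deriv ?_
    simp only [Complex.real_smul]
    push_cast
    ring
  · refine Integrable.mono' (hexp.const_mul M) (Measurable.aestronglyMeasurable ?_) ?_
    · have := hA.measurable
      fun_prop
    filter_upwards [ae_restrict_mem measurableSet_Ioi] with u hu
    have hu : 0 < u := hu
    rw [norm_smul, norm_mul, Real.norm_of_nonneg (Real.exp_nonneg _), mul_comm]
    have h1 := hM (s + u) (by positivity)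
    have h2 := hg1 (s + u)
    gcongr
    nlinarith [norm_nonneg (expTail g (s + u)), norm_nonneg (g (s + u))]
  · have h1 : Tendsto (fun u : ℝ => Real.exp (-u)) atTop (𝓝 0) :=
      Real.tendsto_exp_neg_atTop_nhds_zero
    have h2 := (tendsto_expTail hint).comp (tendsto_atTop_add_const_left atTop s tendsto_id)
    simpa using (h1.smul h2).neg

end Renewal

/-! ### Multiplicative functionals of the arrival times -/

section Arrival

variable {Ω : Type*} [MeasurableSpace Ω] {P : Measure Ω}
  {ξ : ℕ → Ω → ℝ}

theorem ae_forall_pos_of_map_eq_expMeasure (hm : ∀ n, Measurable (ξ n))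
    (hlaw : ∀ n, P.map (ξ n) = expMeasure 1) : ∀ᵐ ω ∂P, ∀ n, 0 < ξ n ω := by
  refine ae_all_iff.2 fun n => ae_of_ae_map (hm n).aemeasurable ?_
  rw [hlaw n]
  exact expMeasure_one_ae_pos

theorem ae_tendsto_arrival_div (hm : ∀ n, Measurable (ξ n))
    (hlaw : ∀ n, P.map (ξ n) = expMeasure 1) (hind : iIndepFun ξ P) :
    ∀ᵐ ω ∂P, Tendsto (fun n : ℕ => (∑ i ∈ Finset.range n, ξ i ω) / n) atTop (𝓝 1) := by
  have hid : ∀ n, IdentDistrib (ξ n) (ξ 0) P P := fun n =>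
    ⟨(hm n).aemeasurable, (hm 0).aemeasurable, by rw [hlaw, hlaw]⟩
  have hint : Integrable (ξ 0) P := by
    have h := integrable_id_expMeasure_one
    rw [← hlaw 0] at h
    exact (integrable_map_measure (by fun_prop) (hm 0).aemeasurable).1 h
  have hmean : ∫ ω, ξ 0 ω ∂P = 1 := by
    have h := integral_id_expMeasure_one
    rwa [← hlaw 0, integral_map (hm 0).aemeasurable (by fun_prop)] at h
  have h := strong_law_ae_real ξ hint (fun i j hij => hind.indepFun hij) hid
  rwa [hmean] at h

variable [IsProbabilityMeasure P] {g : ℝ → ℂ}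

/-- A martingale argument: given the first N waiting times, integrating out the next one by
`integral_expMeasure_expTail`, with s the N-th arrival time, turns the expression for N + 1 into
that for N. At N = 0 the arrival time is the empty sum 0. -/
theorem integral_expTail_mul_prod (hm : ∀ n, Measurable (ξ n))
    (hlaw : ∀ n, P.map (ξ n) = expMeasure 1) (hind : iIndepFun ξ P)
    (hgm : Measurable g) (hc : ContinuousOn g (Set.Ioi 0))
    (hg1 : ∀ r, ‖g r‖ ≤ 1)
    (hint : IntegrableOn (fun r => 1 - g r) (Set.Ioi 0)) (N : ℕ) :
    ∫ ω, expTail g (∑ i ∈ Finset.range N, ξ i ω) *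
      ∏ n ∈ Finset.range N, g (∑ i ∈ Finset.range (n + 1), ξ i ω) ∂P = expTail g 0 := by
  have hA := (continuous_expTail hint).measurable
  obtain ⟨M, hM⟩ := exists_norm_expTail_le hint
  have hpos := ae_forall_pos_of_map_eq_expMeasure hm hlaw
  have hsum : ∀ᵐ ω ∂P, ∀ n, 0 ≤ ∑ i ∈ Finset.range n, ξ i ω :=
    hpos.mono fun ω h n => Finset.sum_nonneg fun i _ => (h i).le
  induction N with
  | zero => simp
  | succ N ih =>
    set W : Ω → ℂ × ℝ := fun ω =>
      (∏ n ∈ Finset.range N, g (∑ i ∈ Finset.range (n + 1), ξ i ω),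
        ∑ i ∈ Finset.range N, ξ i ω) with hW
    have hWm : Measurable W := by fun_prop
    have hWξ : IndepFun W (ξ N) P := by
      have h := indep_iSup_of_disjoint (fun n => (hm n).comap_le) hind.iIndep
        (S := (Set.Iio N)) (T := {N}) (by simp)
      rw [iSup_singleton] at h
      refine (IndepFun_iff_Indep _ _ _).2 (indep_of_indep_of_le_left h ?_)
      have hS : ∀ n ≤ N, Measurable[⨆ i ∈ Set.Iio N, (inferInstance : MeasurableSpace ℝ).comap (ξ i)]
          fun ω => ∑ i ∈ Finset.range n, ξ i ω := by
        intro n hn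
        refine Finset.measurable_sum _ fun i hi => ?_
        refine (comap_measurable (ξ i)).mono
          (le_iSup₂ (f := fun i (_ : i ∈ Set.Iio N) => (inferInstance : MeasurableSpace ℝ).comap (ξ i))
            i ((Finset.mem_range.1 hi).trans_le hn)) le_rfl
      refine Measurable.comap_le (Measurable.prodMk ?_ (hS N le_rfl))
      refine Finset.measurable_prod _ fun n hn => ?_
      exact hgm.comp (hS (n + 1) (Finset.mem_range.1 hn))
    have : IsProbabilityMeasure (P.map W) := Measure.isProbabilityMeasure_map hWm.aemeasurable
    have : IsProbabilityMeasure (P.map (ξ N)) :=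
      Measure.isProbabilityMeasure_map (hm N).aemeasurable
    have hmap := (indepFun_iff_map_prod_eq_prod_map_map hWm.aemeasurable
      (hm N).aemeasurable).1 hWξ
    let F : (ℂ × ℝ) × ℝ → ℂ := fun p =>
      p.1.1 * (expTail g (p.1.2 + p.2) * g (p.1.2 + p.2))
    have hFm : Measurable F := by fun_prop
    have hFi : Integrable F ((P.map W).prod (P.map (ξ N))) := by
      rw [← hmap]
      refine (integrable_map_measure hFm.aestronglyMeasurable (by fun_prop)).2 ?_
      refine Integrable.of_bound (hFm.comp (hWm.prodMk (hm N))).aestronglyMeasurable M ?_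
      filter_upwards [hsum] with ω h
      have h1 : ‖∏ n ∈ Finset.range N, g (∑ i ∈ Finset.range (n + 1), ξ i ω)‖ ≤ 1 := by
        rw [norm_prod]
        exact Finset.prod_le_one (fun _ _ => norm_nonneg _) fun _ _ => hg1 _
      have h2 := hM _ (h (N + 1))
      rw [Finset.sum_range_succ] at h2
      have h3 := hg1 (∑ i ∈ Finset.range N, ξ i ω + ξ N ω)
      have hM0 : 0 ≤ M := (norm_nonneg _).trans h2
      simp only [F, Function.comp, norm_mul, hW]
      calc _ ≤ 1 * (M * 1) := by gcongr
        _ = M := by ring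
    calc _ = ∫ ω, F (W ω, ξ N ω) ∂P := by
          refine integral_congr_ae (ae_of_all _ fun ω => ?_)
          simp only [F, hW, Finset.prod_range_succ, Finset.sum_range_succ]
          ring
      _ = ∫ p, F p ∂((P.map W).prod (P.map (ξ N))) := by
          rw [← hmap, integral_map (by fun_prop) hFm.aestronglyMeasurable]
      _ = ∫ w, w.1 * expTail g w.2 ∂(P.map W) := by
          rw [integral_prod _ hFi]
          refine integral_congr_ae ?_
          have : ∀ᵐ w ∂(P.map W), 0 ≤ w.2 := by
            rw [ae_map_iff hWm.aemeasurable (measurableSet_le (by fun_prop) (by fun_prop))]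
            exact hsum.mono fun ω h => h N
          filter_upwards [this] with w hw
          simp only [F]
          rw [integral_const_mul, hlaw N, integral_expMeasure_expTail hgm hc hg1 hint hw]
      _ = ∫ ω, expTail g (∑ i ∈ Finset.range N, ξ i ω) *
            ∏ n ∈ Finset.range N, g (∑ i ∈ Finset.range (n + 1), ξ i ω) ∂P := by
          rw [integral_map hWm.aemeasurable (by fun_prop)]
          refine integral_congr_ae (ae_of_all _ fun ω => ?_)
          simp only [hW, mul_comm]
      _ = _ := ih

/-- The multiplicative functional of a Poisson process. -/
theorem tendsto_integral_prod_arrival (hm : ∀ n, Measurable (ξ n))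
    (hlaw : ∀ n, P.map (ξ n) = expMeasure 1) (hind : iIndepFun ξ P)
    (hgm : Measurable g) (hc : ContinuousOn g (Set.Ioi 0))
    (hg1 : ∀ r, ‖g r‖ ≤ 1)
    (hint : IntegrableOn (fun r => 1 - g r) (Set.Ioi 0)) :
    Tendsto (fun N => ∫ ω, ∏ n ∈ Finset.range N, g (∑ i ∈ Finset.range (n + 1), ξ i ω) ∂P)
      atTop (𝓝 (Complex.exp (-∫ r in Set.Ioi 0, (1 - g r)))) := by
  have hA := (continuous_expTail hint).measurable
  obtain ⟨M, hM⟩ := exists_norm_expTail_le hint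
  have hpos := ae_forall_pos_of_map_eq_expMeasure hm hlaw
  have hsum : ∀ᵐ ω ∂P, ∀ n, 0 ≤ ∑ i ∈ Finset.range n, ξ i ω :=
    hpos.mono fun ω h n => Finset.sum_nonneg fun i _ => (h i).le
  have htop : ∀ᵐ ω ∂P, Tendsto (fun n => ∑ i ∈ Finset.range n, ξ i ω) atTop atTop := by
    filter_upwards [ae_tendsto_arrival_div hm hlaw hind] with ω h
    have h2 := Tendsto.pos_mul_atTop one_pos h tendsto_natCast_atTop_atTop
    refine h2.congr' ?_
    filter_upwards [eventually_gt_atTop 0] with n hn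
    field_simp
  have hprod : ∀ N ω, ‖∏ n ∈ Finset.range N, g (∑ i ∈ Finset.range (n + 1), ξ i ω)‖ ≤ 1 := by
    intro N ω
    rw [norm_prod]
    exact Finset.prod_le_one (fun _ _ => norm_nonneg _) fun _ _ => hg1 _
  -- The factor A tends to 1 along the arrival times, so dropping it changes nothing in the limit,
  -- and with it the expectation is constant.
  have hlim : Tendsto (fun N => ∫ ω, (1 - expTail g (∑ i ∈ Finset.range N, ξ i ω)) *
      ∏ n ∈ Finset.range N, g (∑ i ∈ Finset.range (n + 1), ξ i ω) ∂P) atTop (𝓝 0) := by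
    rw [← integral_zero Ω ℂ (μ := P)]
    refine tendsto_integral_of_dominated_convergence (fun _ => 1 + M)
      (fun N => Measurable.aestronglyMeasurable (by fun_prop)) (integrable_const _) ?_ ?_
    · intro N
      filter_upwards [hsum] with ω h
      have h1 := norm_sub_le (1 : ℂ) (expTail g (∑ i ∈ Finset.range N, ξ i ω))
      have h2 := hM _ (h N)
      rw [norm_one] at h1
      have hM0 : 0 ≤ M := (norm_nonneg _).trans h2
      rw [norm_mul]
      calc _ ≤ (1 + M) * 1 := by gcongr; exacts [h1.trans (by gcongr), hprod N ω]
        _ = _ := mul_one _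
    · filter_upwards [htop] with ω h
      have h1 := ((tendsto_expTail hint).comp h).const_sub 1
      rw [sub_self] at h1
      exact h1.zero_mul_isBoundedUnder_le
        (isBoundedUnder_of ⟨1, fun N => hprod N ω⟩)
  have h := hlim.add_const (expTail g 0)
  rw [zero_add, expTail_zero] at h
  refine h.congr fun N => ?_
  rw [← expTail_zero, ← integral_expTail_mul_prod hm hlaw hind hgm hc hg1 hint N, ← integral_add]
  · refine integral_congr_ae (ae_of_all _ fun ω => ?_)
    ring
  · refine Integrable.of_bound (Measurable.aestronglyMeasurable (by fun_prop)) (1 + M) ?_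
    filter_upwards [hsum] with ω h
    have h1 := norm_sub_le (1 : ℂ) (expTail g (∑ i ∈ Finset.range N, ξ i ω))
    have h2 := hM _ (h N)
    rw [norm_one] at h1
    have hM0 : 0 ≤ M := (norm_nonneg _).trans h2
    rw [norm_mul]
    calc _ ≤ (1 + M) * 1 := by gcongr; exacts [h1.trans (by gcongr), hprod N ω]
      _ = _ := mul_one _
  · refine Integrable.of_bound (Measurable.aestronglyMeasurable (by fun_prop)) M ?_
    filter_upwards [hsum] with ω h
    have h2 := hM _ (h N)
    have hM0 : 0 ≤ M := (norm_nonneg _).trans h2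
    rw [norm_mul]
    calc _ ≤ M * 1 := by gcongr; exact hprod N ω
      _ = _ := mul_one _

end Arrival

/-! ### Integrals and sums of truncated powers -/

section TruncatedPower

/-- Splitting at r = t, the two pieces are at most t and t/(p - 1), with sum tp/(p - 1). Linearity
in t is what makes a moment of order α sufficient later. -/
theorem lintegral_min_one_div_rpow_le {p t : ℝ} (hp : 1 < p) (ht : 0 ≤ t) :
    ∫⁻ r in Set.Ioi 0, ENNReal.ofReal (min 1 ((t / r) ^ p)) ≤
      ENNReal.ofReal (p / (p - 1)) * ENNReal.ofReal t := by
  rcases ht.eq_or_lt with rfl | ht'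
  · simp [Real.zero_rpow (by linarith : p ≠ 0)]
  have hp' : 0 < p - 1 := by linarith
  rw [← Set.Ioc_union_Ioi_eq_Ioi ht, lintegral_union measurableSet_Ioi
    (Set.Ioc_disjoint_Ioi le_rfl)]
  have h1 : ∫⁻ r in Set.Ioc 0 t, ENNReal.ofReal (min 1 ((t / r) ^ p)) ≤ ENNReal.ofReal t := by
    calc _ ≤ ∫⁻ r in Set.Ioc 0 t, 1 := by
          refine lintegral_mono fun r => ?_
          rw [← ENNReal.ofReal_one]
          exact ENNReal.ofReal_le_ofReal (min_le_left _ _)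
      _ = ENNReal.ofReal t := by simp
  have h2 : ∫⁻ r in Set.Ioi t, ENNReal.ofReal (min 1 ((t / r) ^ p)) ≤
      ENNReal.ofReal (t / (p - 1)) := by
    have hi : IntegrableOn (fun r : ℝ => t ^ p * r ^ (-p)) (Set.Ioi t) :=
      (integrableOn_Ioi_rpow_of_lt (by linarith) ht').const_mul _
    calc _ ≤ ∫⁻ r in Set.Ioi t, ENNReal.ofReal (t ^ p * r ^ (-p)) := by
          refine setLIntegral_mono_ae (by fun_prop) (ae_of_all _ fun r hr => ?_)
          have hr0 : 0 < r := ht'.trans hr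
          refine ENNReal.ofReal_le_ofReal ((min_le_right _ _).trans_eq ?_)
          rw [Real.div_rpow ht hr0.le, Real.rpow_neg hr0.le, div_eq_mul_inv]
      _ = ENNReal.ofReal (∫ r in Set.Ioi t, t ^ p * r ^ (-p)) := by
          rw [ofReal_integral_eq_lintegral_ofReal hi]
          filter_upwards [ae_restrict_mem measurableSet_Ioi] with r hr
          have hr0 : 0 < r := ht'.trans hr
          positivity
      _ = _ := by
          congr 1
          have ht1 : t ^ p * t ^ (-p + 1) = t := by
            rw [← Real.rpow_add ht', add_neg_cancel_left, Real.rpow_one]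
          rw [integral_const_mul, integral_Ioi_rpow_of_lt (by linarith) ht', mul_div_assoc',
            mul_neg, ht1, ← neg_div_neg_eq]
          ring_nf
  calc _ ≤ ENNReal.ofReal t + ENNReal.ofReal (t / (p - 1)) := add_le_add h1 h2
    _ = _ := by
      rw [← ENNReal.ofReal_add ht (by positivity), ← ENNReal.ofReal_mul (by positivity)]
      congr 1
      field_simp
      ring

/-- The function of r is nonincreasing, so its value at n + 1 is at most its integral over (n, n +
1]. -/
theorem tsum_min_one_div_rpow_le {p t : ℝ} (hp : 1 < p) (ht : 0 ≤ t) :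
    ∑' n : ℕ, ENNReal.ofReal (min 1 ((t / (n + 1)) ^ p)) ≤
      ENNReal.ofReal (p / (p - 1)) * ENNReal.ofReal t := by
  refine le_trans ?_ (lintegral_min_one_div_rpow_le hp ht)
  have hdisj : Pairwise (Function.onFun Disjoint fun n : ℕ => Set.Ioc (n : ℝ) (n + 1)) := by
    have h := Set.pairwise_disjoint_Ioc_intCast ℝ
    intro m n hmn
    have := h (i := (m : ℤ)) (j := (n : ℤ)) (by exact_mod_cast hmn)
    simpa [Function.onFun] using this
  calc _ ≤ ∑' n : ℕ, ∫⁻ r in Set.Ioc (n : ℝ) (n + 1), ENNReal.ofReal (min 1 ((t / r) ^ p)) := by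
        refine ENNReal.tsum_le_tsum fun n => ?_
        calc _ = ∫⁻ r in Set.Ioc (n : ℝ) (n + 1), ENNReal.ofReal (min 1 ((t / (n + 1)) ^ p)) := by
              simp
          _ ≤ _ := by
              refine setLIntegral_mono_ae (by fun_prop) (ae_of_all _ fun r hr => ?_)
              have hr0 : 0 < r := lt_of_le_of_lt (Nat.cast_nonneg n) hr.1
              have hr2 := hr.2
              gcongr
    _ = ∫⁻ r in ⋃ n : ℕ, Set.Ioc (n : ℝ) (n + 1), ENNReal.ofReal (min 1 ((t / r) ^ p)) :=
        (lintegral_iUnion (fun n => measurableSet_Ioc) hdisj _).symm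
    _ ≤ _ := by
        refine lintegral_mono_set (Set.iUnion_subset fun n r hr => ?_)
        exact lt_of_le_of_lt (Nat.cast_nonneg n) hr.1

end TruncatedPower

/-! ### Integrability of the Lévy–Khintchine integrand -/

section ShotKernel

variable {E : Type*} [NormedAddCommGroup E] [NormedSpace ℝ E]

/-- Puts the squared norm in the form (t/r)^p of the truncated power bounds, with t = ‖v‖^α and p =
2/α > 1 when α < 2. -/
theorem sq_norm_shotKernel {α r : ℝ} (hα : 0 < α) (hr : 0 < r) (v : E) :
    ‖shotKernel α r v‖ ^ 2 = (‖v‖ ^ α / r) ^ (2 / α) := by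
  have h1 : (r ^ (-1 / α)) ^ 2 = (r ^ (2 / α))⁻¹ := by
    rw [← Real.rpow_natCast, ← Real.rpow_mul hr.le, ← Real.rpow_neg hr.le]
    congr 1
    push_cast
    ring
  rw [shotKernel, norm_smul, Real.norm_of_nonneg (by positivity), mul_pow, h1,
    Real.div_rpow (by positivity) hr.le, ← Real.rpow_mul (norm_nonneg v),
    mul_div_cancel₀ _ hα.ne', Real.rpow_two, mul_comm]
  exact (div_eq_mul_inv _ _).symm

/-- In the unit ball, the Taylor remainder is at most |y' y|² if |y' y| ≤ 1, and otherwise at most 2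
+ |y' y| ≤ 3|y' y|². Outside the ball the compensator vanishes and 2 is a bound. -/
theorem norm_levyKhintchineIntegrand_le (y' : StrongDual ℝ E) (y : E) :
    ‖levyKhintchineIntegrand y' y‖ ≤ (3 * ‖y'‖ ^ 2 + 2) * min 1 (‖y‖ ^ 2) := by
  have hexp : ‖Complex.exp (Complex.I * (y' y : ℂ))‖ = 1 := by
    rw [mul_comm, Complex.norm_exp_ofReal_mul_I]
  have hI : ‖Complex.I * (y' y : ℂ)‖ = |y' y| := by simp
  have h2 : ‖Complex.exp (Complex.I * (y' y : ℂ)) - 1‖ ≤ 2 := by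
    refine (norm_sub_le _ _).trans ?_
    rw [hexp, norm_one]; norm_num
  rw [levyKhintchineIntegrand]
  by_cases hy : ‖y‖ ≤ 1
  · rw [Set.indicator_of_mem (by exact hy), min_eq_right (by nlinarith [norm_nonneg y])]
    have h3 : ‖Complex.exp (Complex.I * (y' y : ℂ)) - 1 - Complex.I * (y' y : ℂ)‖ ≤
        3 * |y' y| ^ 2 := by
      by_cases h1 : |y' y| ≤ 1
      · refine (Complex.norm_exp_sub_one_sub_id_le (hI.trans_le h1)).trans ?_
        rw [hI]; nlinarith [abs_nonneg (y' y)]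
      · refine (norm_sub_le _ _).trans ?_
        rw [hI]; nlinarith
    refine h3.trans ?_
    have h4 : |y' y| ≤ ‖y'‖ * ‖y‖ := y'.le_opNorm y
    calc _ ≤ 3 * (‖y'‖ * ‖y‖) ^ 2 := by gcongr
      _ ≤ _ := by nlinarith [sq_nonneg ‖y‖]
  · rw [Set.indicator_of_notMem (by exact hy), sub_zero, min_eq_left (by nlinarith)]
    refine h2.trans ?_
    nlinarith [sq_nonneg ‖y'‖]

variable [MeasurableSpace E] [BorelSpace E]

theorem measurable_levyKhintchineIntegrand (y' : StrongDual ℝ E) :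
    Measurable (levyKhintchineIntegrand y') := by
  unfold levyKhintchineIntegrand
  have := y'.continuous.measurable
  have h1 : Measurable fun z => Complex.I * (y' z : ℂ) := by fun_prop
  exact (((Complex.measurable_exp.comp h1).sub_const 1)).sub
    (h1.indicator (measurableSet_le measurable_norm measurable_const))

variable [SecondCountableTopology E]

theorem measurable_shotKernel (α : ℝ) :
    Measurable fun p : ℝ × E => shotKernel α p.1 p.2 := by
  unfold shotKernel
  exact (measurable_fst.pow_const _).smul measurable_snd

theorem integrable_levyKhintchineIntegrand_shotKernel {α : ℝ} (hα0 : 0 < α) (hα2 : α < 2)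
    {μ : Measure E} [SFinite μ] (hμ : ∫⁻ v, ‖v‖ₑ ^ α ∂μ ≠ ∞) (y' : StrongDual ℝ E) :
    Integrable (fun p : ℝ × E => levyKhintchineIntegrand y' (shotKernel α p.1 p.2))
      ((volume.restrict (Set.Ioi 0)).prod μ) := by
  have hp : 1 < 2 / α := by rwa [one_lt_div hα0]
  have hm := (measurable_levyKhintchineIntegrand y').comp (measurable_shotKernel (E := E) α)
  refine ⟨hm.aestronglyMeasurable, ?_⟩
  rw [hasFiniteIntegral_iff_enorm]
  have hb : ∀ v : E, ∫⁻ r in Set.Ioi 0, ‖levyKhintchineIntegrand y' (shotKernel α r v)‖ₑ ≤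
      ENNReal.ofReal (3 * ‖y'‖ ^ 2 + 2) *
        (ENNReal.ofReal (2 / α / (2 / α - 1)) * ‖v‖ₑ ^ α) := by
    intro v
    have hv : ‖v‖ₑ ^ α = ENNReal.ofReal (‖v‖ ^ α) := by
      rw [← ofReal_norm, ENNReal.ofReal_rpow_of_nonneg (norm_nonneg _) hα0.le]
    rw [hv]
    calc _ ≤ ∫⁻ r in Set.Ioi 0, ENNReal.ofReal (3 * ‖y'‖ ^ 2 + 2) *
          ENNReal.ofReal (min 1 ((‖v‖ ^ α / r) ^ (2 / α))) := by
          refine setLIntegral_mono_ae (by fun_prop) (ae_of_all _ fun r hr => ?_)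
          rw [← sq_norm_shotKernel hα0 hr, ← ENNReal.ofReal_mul (by positivity),
            ← ofReal_norm]
          exact ENNReal.ofReal_le_ofReal (norm_levyKhintchineIntegrand_le _ _)
      _ ≤ _ := by
          rw [lintegral_const_mul _ (by fun_prop)]
          gcongr
          exact lintegral_min_one_div_rpow_le hp (by positivity)
  rw [lintegral_prod_symm' _ (by fun_prop)]
  refine (lintegral_mono hb).trans_lt ?_
  rw [lintegral_const_mul _ (by fun_prop), lintegral_const_mul _ (by fun_prop)]
  exact ENNReal.mul_lt_top ENNReal.ofReal_lt_top
    (ENNReal.mul_lt_top ENNReal.ofReal_lt_top hμ.lt_top)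

end ShotKernel

/-! ### Almost sure convergence of series of independent symmetric variables -/

section RandomSeries

variable {Ω : Type*} [MeasurableSpace Ω] {P : Measure Ω} [IsProbabilityMeasure P]

/-- A series of independent centered variables with summable variances converges almost surely. -/
theorem ae_exists_tendsto_sum_of_tsum_variance {Y : ℕ → Ω → ℝ} (hm : ∀ n, Measurable (Y n))
    (hind : iIndepFun Y P) (hL : ∀ n, MemLp (Y n) 2 P) (h0 : ∀ n, ∫ ω, Y n ω ∂P = 0)
    (hs : ∑' n, eVar[Y n; P] ≠ ∞) :
    ∀ᵐ ω ∂P, ∃ l, Tendsto (fun N => ∑ n ∈ Finset.range N, Y n ω) atTop (𝓝 l) := by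
  have hsm : ∀ n, StronglyMeasurable (Y n) := fun n => (hm n).stronglyMeasurable
  have hint : ∀ n, Integrable (Y n) P := fun n => (hL n).integrable (by norm_num)
  -- With N + 1 terms, `M N` involves exactly the variables up to index N and is adapted to the
  -- natural filtration.
  let M : ℕ → Ω → ℝ := fun N => ∑ n ∈ Finset.range (N + 1), Y n
  let F := Filtration.natural Y hsm
  have hYF : ∀ n, StronglyMeasurable[F n] (Y n) :=
    Filtration.stronglyAdapted_natural hsm
  have hadp : StronglyAdapted F M := by
    intro N
    refine Finset.stronglyMeasurable_sum _ fun n hn => ?_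
    exact (hYF n).mono (F.mono (Nat.lt_succ_iff.1 (Finset.mem_range.1 hn)))
  have hMint : ∀ N, Integrable (M N) P := fun N => integrable_finsetSum' _ fun n _ => hint n
  have hmart : Martingale M F P := by
    refine martingale_nat hadp hMint fun N => ?_
    have h1 : M (N + 1) = M N + Y (N + 1) := Finset.sum_range_succ _ _
    rw [h1]
    have h2 := condExp_add (hMint N) (hint (N + 1)) (F N)
    have h3 := hind.condExp_natural_ae_eq_of_lt hsm (Nat.lt_succ_self N)
    filter_upwards [h2, h3] with ω h2 h3
    rw [h2, Pi.add_apply, condExp_of_stronglyMeasurable (F.le N) (hadp N) (hMint N)]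
    change M N ω = M N ω + P[Y (N + 1)|F N] ω
    rw [h3, h0, add_zero]
  have hML : ∀ N, MemLp (M N) 2 P := fun N => memLp_finsetSum' _ fun n _ => hL n
  have hvar : ∀ N, ∫ ω, M N ω ^ 2 ∂P ≤ (∑' n, eVar[Y n; P]).toReal := by
    intro N
    have hM0 : ∫ ω, M N ω ∂P = 0 := by
      simp only [M, Finset.sum_apply]
      rw [integral_finsetSum _ fun n _ => hint n]
      exact Finset.sum_eq_zero fun n _ => h0 n
    rw [← variance_of_integral_eq_zero (hML N).aestronglyMeasurable.aemeasurable hM0,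
      IndepFun.variance_sum (fun n _ => hL n) fun i _ j _ hij => hind.indepFun hij]
    simp only [variance]
    rw [← ENNReal.toReal_sum fun n _ => (hL n).evariance_ne_top]
    exact ENNReal.toReal_mono hs (ENNReal.sum_le_tsum _)
  have hbdd : ∀ N, eLpNorm (M N) 1 P ≤ ((1 + (∑' n, eVar[Y n; P]).toReal).toNNReal : ℝ≥0∞) := by
    intro N
    have hsq : Integrable (fun ω => M N ω ^ 2) P := (hML N).integrable_sq
    rw [eLpNorm_one_eq_lintegral_enorm, ← ofReal_integral_norm_eq_lintegral_enorm (hMint N)]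
    refine ENNReal.ofReal_le_ofReal ?_
    calc ∫ ω, ‖M N ω‖ ∂P ≤ ∫ ω, (1 + M N ω ^ 2) ∂P := by
          refine integral_mono (hMint N).norm ((integrable_const _).add hsq) fun ω => ?_
          rw [Real.norm_eq_abs, ← sq_abs (M N ω)]
          nlinarith [sq_nonneg (|M N ω| - 1), abs_nonneg (M N ω)]
      _ ≤ _ := by
          rw [integral_add (integrable_const _) hsq]
          simpa using hvar N
  filter_upwards [hmart.submartingale.exists_ae_tendsto_of_bdd hbdd] with ω ⟨l, hl⟩
  refine ⟨l, (tendsto_add_atTop_iff_nat 1).1 ?_⟩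
  simpa [M] using hl

/-- A series of independent symmetric variables `Z n` with `∑ E[min (1, (Z n)²)] < ∞`
converges almost surely. -/
theorem ae_exists_tendsto_sum_of_symmetric {Z : ℕ → Ω → ℝ} (hm : ∀ n, Measurable (Z n))
    (hind : iIndepFun Z P) (hsymm : ∀ n, IdentDistrib (fun ω => - Z n ω) (Z n) P P)
    (hs : ∑' n, ∫⁻ ω, ENNReal.ofReal (min 1 (Z n ω ^ 2)) ∂P ≠ ∞) :
    ∀ᵐ ω ∂P, ∃ l, Tendsto (fun N => ∑ n ∈ Finset.range N, Z n ω) atTop (𝓝 l) := by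
  -- Truncation at 1 is odd, so symmetry makes the truncated variables centered; their variances are
  -- summable. By Borel–Cantelli only finitely many terms are altered.
  let t : ℝ → ℝ := fun x => if |x| ≤ 1 then x else 0
  have htm : Measurable t :=
    Measurable.ite (measurableSet_le (by fun_prop) measurable_const) measurable_id measurable_const
  have ht1 : ∀ x, ‖t x‖ ≤ 1 := by
    intro x
    by_cases h : |x| ≤ 1 <;> simp [t, h]
  have ht2 : ∀ x, t x ^ 2 ≤ min 1 (x ^ 2) := by
    intro x
    by_cases h : |x| ≤ 1
    · have : x ^ 2 ≤ 1 := by rw [← sq_abs]; nlinarith [abs_nonneg x]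
      simp [t, h, this]
    · simp [t, h, sq_nonneg]
  have htn : ∀ x, t (-x) = - t x := by
    intro x
    by_cases h : |x| ≤ 1 <;> simp [t, h]
  have hL : ∀ n, MemLp (fun ω => t (Z n ω)) 2 P := fun n =>
    MemLp.of_bound (htm.comp (hm n)).aestronglyMeasurable 1 (ae_of_all _ fun ω => ht1 _)
  have h0 : ∀ n, ∫ ω, t (Z n ω) ∂P = 0 := by
    intro n
    have h := ((hsymm n).comp htm).integral_eq
    simp only [Function.comp_def, htn, integral_neg] at h
    linarith
  have hvar : ∑' n, eVar[fun ω => t (Z n ω); P] ≠ ∞ := by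
    refine ne_top_of_le_ne_top hs (ENNReal.tsum_le_tsum fun n => ?_)
    rw [evariance_eq_lintegral_ofReal, h0]
    refine lintegral_mono fun ω => ENNReal.ofReal_le_ofReal ?_
    rw [sub_zero]
    exact ht2 _
  have hconv := ae_exists_tendsto_sum_of_tsum_variance (fun n => htm.comp (hm n))
    (hind.comp (fun _ => t) fun _ => htm) hL h0 hvar
  have hBC : ∀ᵐ ω ∂P, ∀ᶠ n in atTop, ω ∉ {ω | 1 < |Z n ω|} := by
    refine ae_eventually_notMem (ne_top_of_le_ne_top hs (ENNReal.tsum_le_tsum fun n => ?_))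
    have hset : MeasurableSet {ω | 1 < |Z n ω|} :=
      measurableSet_lt measurable_const (hm n).abs
    rw [← lintegral_indicator_one hset]
    refine lintegral_mono fun ω => ?_
    by_cases hω : 1 < |Z n ω|
    · rw [Set.indicator_of_mem (by exact hω), min_eq_left (by rw [← sq_abs]; nlinarith)]
      simp
    · rw [Set.indicator_of_notMem (by exact hω)]
      exact zero_le
  filter_upwards [hconv, hBC] with ω ⟨l, hl⟩ hω
  obtain ⟨n₀, hn₀⟩ := eventually_atTop.1 hω
  have hd : HasSum (fun n => Z n ω - t (Z n ω))
      (∑ n ∈ Finset.range n₀, (Z n ω - t (Z n ω))) := by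
    refine hasSum_sum_of_ne_finset_zero fun n hn => ?_
    have : |Z n ω| ≤ 1 := not_lt.1 (hn₀ n (by simpa using hn))
    simp [t, this]
  refine ⟨_, (hl.add hd.tendsto_sum_nat).congr fun N => ?_⟩
  rw [← Finset.sum_add_distrib]
  simp

end RandomSeries

/-! ### Arrival times and almost sure convergence of the tested shot series -/

theorem IsUnitPoissonArrivalTimes.measurable {Ω : Type*} [MeasurableSpace Ω] {P : Measure Ω}
    {Γ : ℕ → Ω → ℝ} (hΓ : IsUnitPoissonArrivalTimes Γ P) (n : ℕ) : Measurable (Γ n) := by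
  obtain ⟨ξ, hm, -, -, h⟩ := hΓ
  rw [funext (h n)]
  fun_prop

/-- By the law of large numbers (n + 1)/Γ n tends to 1, hence is bounded. A natural number k as
bound makes the event a countable union, so measurable. -/
theorem IsUnitPoissonArrivalTimes.ae_exists_le {Ω : Type*} [MeasurableSpace Ω] {P : Measure Ω}
    {Γ : ℕ → Ω → ℝ} (hΓ : IsUnitPoissonArrivalTimes Γ P) :
    ∀ᵐ ω ∂P, ∃ k : ℕ, ∀ n : ℕ, ((n : ℝ) + 1) / (k + 1) ≤ Γ n ω := by
  obtain ⟨ξ, hm, hlaw, hind, h⟩ := hΓ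
  filter_upwards [ae_tendsto_arrival_div hm hlaw hind,
    ae_forall_pos_of_map_eq_expMeasure hm hlaw] with ω h1 h2
  have hpos : ∀ n, 0 < Γ n ω := fun n => by
    rw [h]
    exact Finset.sum_pos (fun i _ => h2 i) (by simp)
  have h3 : Tendsto (fun n : ℕ => (((n : ℝ) + 1) / Γ n ω)) atTop (𝓝 1) := by
    have h4 := (h1.comp (tendsto_add_atTop_nat 1)).inv₀ one_ne_zero
    rw [inv_one] at h4
    refine h4.congr fun n => ?_
    simp [h n ω]
  obtain ⟨b, hb⟩ := h3.bddAbove_range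
  obtain ⟨k, hk⟩ := exists_nat_gt b
  refine ⟨k, fun n => ?_⟩
  have h5 : ((n : ℝ) + 1) / Γ n ω ≤ b := hb ⟨n, rfl⟩
  rw [div_le_iff₀ (by positivity)]
  rw [div_le_iff₀ (hpos n)] at h5
  nlinarith [hpos n]

section ShotSeries

variable {Ω E : Type*} [MeasurableSpace Ω] {P : Measure Ω} [IsProbabilityMeasure P]
  [NormedAddCommGroup E] [NormedSpace ℝ E] [MeasurableSpace E] [BorelSpace E]
  [SecondCountableTopology E] {α : ℝ} {Γ : ℕ → Ω → ℝ} {V : ℕ → Ω → E}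

/-- The arrival times are frozen to a sequence of at least linear growth. With C = ‖y'‖^α / c, the
n-th truncated second moment is at most E min(1, (C‖V‖^α/(n + 1))^(2/α)), and these sum to at most a
multiple of E‖V‖^α. -/
theorem ae_exists_tendsto_sum_shotKernel (hα0 : 0 < α) (hα2 : α < 2)
    (hVm : ∀ n, Measurable (V n)) (hV : iIndepFun V P) (hVd : ∀ n, P.map (V n) = P.map (V 0))
    (hVs : (P.map (V 0)).map (fun v => -v) = P.map (V 0))
    (hmom : ∫⁻ v, ‖v‖ₑ ^ α ∂(P.map (V 0)) ≠ ∞) (y' : StrongDual ℝ E)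
    {γ : ℕ → ℝ} {c : ℝ} (hc : 0 < c) (hγ : ∀ n : ℕ, c * (n + 1) ≤ γ n) :
    ∀ᵐ ω ∂P, ∃ l, Tendsto (fun N => ∑ n ∈ Finset.range N, y' (shotKernel α (γ n) (V n ω)))
      atTop (𝓝 l) := by
  have hp : 1 < 2 / α := by rwa [one_lt_div hα0]
  have hγ0 : ∀ n, 0 < γ n := fun n => lt_of_lt_of_le (by positivity) (hγ n)
  have hlm : ∀ n, Measurable fun v : E => y' (shotKernel α (γ n) v) := fun n =>
    y'.continuous.measurable.comp (measurable_id.const_smul (γ n ^ (-1 / α)))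
  refine ae_exists_tendsto_sum_of_symmetric (fun n => (hlm n).comp (hVm n))
    (hV.comp (fun n v => y' (shotKernel α (γ n) v)) hlm) (fun n => ?_) ?_
  · have h : IdentDistrib (fun ω => - V n ω) (V n) P P := by
      refine ⟨(hVm n).neg.aemeasurable, (hVm n).aemeasurable, ?_⟩
      rw [hVd n, ← hVs, ← hVd n, Measure.map_map measurable_neg (hVm n)]
      rfl
    have h2 := h.comp (hlm n)
    convert h2 using 1
    · ext ω
      simp [shotKernel]
    · rfl
  · set C : ℝ := ‖y'‖ ^ α / c
    have hC : 0 ≤ C := by positivity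
    have hb : ∀ n (v : E), ENNReal.ofReal (min 1 (y' (shotKernel α (γ n) v) ^ 2)) ≤
        ENNReal.ofReal (min 1 ((C * ‖v‖ ^ α / (n + 1)) ^ (2 / α))) := by
      intro n v
      refine ENNReal.ofReal_le_ofReal (min_le_min le_rfl ?_)
      have h1 : |y' (shotKernel α (γ n) v)| ≤ ‖y'‖ * ‖shotKernel α (γ n) v‖ := y'.le_opNorm _
      have h2 : ‖y'‖ ^ 2 = (‖y'‖ ^ α) ^ (2 / α) := by
        rw [← Real.rpow_mul (norm_nonneg _), mul_div_cancel₀ _ hα0.ne', Real.rpow_two]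
      calc _ = |y' (shotKernel α (γ n) v)| ^ 2 := (sq_abs _).symm
        _ ≤ (‖y'‖ * ‖shotKernel α (γ n) v‖) ^ 2 := by gcongr
        _ = (‖y'‖ ^ α * (‖v‖ ^ α / γ n)) ^ (2 / α) := by
          have := (hγ0 n).le
          rw [mul_pow, sq_norm_shotKernel hα0 (hγ0 n), h2, Real.mul_rpow (by positivity)
            (by positivity)]
        _ ≤ _ := by
          have := (hγ0 n).le
          refine Real.rpow_le_rpow (by positivity) ?_ (by positivity)
          calc _ ≤ ‖y'‖ ^ α * (‖v‖ ^ α / (c * (n + 1))) := by gcongr; exact hγ n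
            _ = _ := by simp only [C]; field_simp
    have hmeas : ∀ n : ℕ, Measurable fun v : E =>
        ENNReal.ofReal (min 1 ((C * ‖v‖ ^ α / (n + 1)) ^ (2 / α))) := fun n => by fun_prop
    refine ne_top_of_le_ne_top (b := ENNReal.ofReal (2 / α / (2 / α - 1)) *
      (ENNReal.ofReal C * ∫⁻ v, ‖v‖ₑ ^ α ∂(P.map (V 0)))) (by finiteness) ?_
    calc _ ≤ ∑' n : ℕ, ∫⁻ v, ENNReal.ofReal (min 1 ((C * ‖v‖ ^ α / (n + 1)) ^ (2 / α)))
          ∂(P.map (V 0)) := by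
          refine ENNReal.tsum_le_tsum fun n => ?_
          rw [← hVd n, lintegral_map (hmeas n) (hVm n)]
          exact lintegral_mono fun ω => hb n _
      _ = ∫⁻ v, ∑' n : ℕ, ENNReal.ofReal (min 1 ((C * ‖v‖ ^ α / (n + 1)) ^ (2 / α)))
          ∂(P.map (V 0)) := (lintegral_tsum fun n => (hmeas n).aemeasurable).symm
      _ ≤ ∫⁻ v, ENNReal.ofReal (2 / α / (2 / α - 1)) * (ENNReal.ofReal C * ‖v‖ₑ ^ α)
          ∂(P.map (V 0)) := by
          refine lintegral_mono fun v => ?_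
          refine (tsum_min_one_div_rpow_le hp (by positivity)).trans_eq ?_
          rw [ENNReal.ofReal_mul hC, ← ofReal_norm (E := E),
            ENNReal.ofReal_rpow_of_nonneg (norm_nonneg _) hα0.le]
      _ = _ := by
          rw [lintegral_const_mul _ (by fun_prop), lintegral_const_mul _ (by fun_prop)]

end ShotSeries

/-! ### Characteristic functions of the partial sums and their limit -/

/-- The marks `V n` of the shot series are i.i.d., symmetric, independent of the arrival times
`Γ n`, and have a finite absolute moment of order `α`. -/
structure IsSymmetricShot {Ω E : Type*} [MeasurableSpace Ω] [NormedAddCommGroup E]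
    [MeasurableSpace E] (α : ℝ) (Γ : ℕ → Ω → ℝ) (V : ℕ → Ω → E) (P : Measure Ω) : Prop where
  arrival : IsUnitPoissonArrivalTimes Γ P
  measurable : ∀ n, Measurable (V n)
  iIndepFun : iIndepFun V P
  map_eq : ∀ n, P.map (V n) = P.map (V 0)
  map_neg : (P.map (V 0)).map (fun v => -v) = P.map (V 0)
  indepFun : IndepFun (fun ω n => Γ n ω) (fun ω n => V n ω) P
  moment : ∫⁻ v, ‖v‖ₑ ^ α ∂(P.map (V 0)) ≠ ∞

section ShotSeries

variable {Ω E : Type*} [MeasurableSpace Ω] {P : Measure Ω} [IsProbabilityMeasure P]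
  [NormedAddCommGroup E] [MeasurableSpace E] {α : ℝ} {Γ : ℕ → Ω → ℝ} {V : ℕ → Ω → E}

theorem IsSymmetricShot.map_prodMk (h : IsSymmetricShot α Γ V P) :
    P.map (fun ω => ((fun n => Γ n ω), fun n => V n ω)) =
      (P.map fun ω n => Γ n ω).prod (P.map fun ω n => V n ω) :=
  (indepFun_iff_map_prod_eq_prod_map_map
    (measurable_pi_lambda _ h.arrival.measurable).aemeasurable
    (measurable_pi_lambda _ h.measurable).aemeasurable).1 h.indepFun

variable [NormedSpace ℝ E]

/-- `E[exp (i ⟨y', h (r, V 0)⟩)]`, as a function of `r`. -/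
noncomputable def shotCharFun (α : ℝ) (μ : Measure E) (y' : StrongDual ℝ E) (r : ℝ) : ℂ :=
  ∫ v, Complex.exp (Complex.I * (y' (shotKernel α r v) : ℂ)) ∂μ

theorem norm_exp_I_mul_ofReal (x : ℝ) : ‖Complex.exp (Complex.I * (x : ℂ))‖ = 1 := by
  rw [mul_comm, Complex.norm_exp_ofReal_mul_I]

theorem norm_shotCharFun_le (α : ℝ) (μ : Measure E) [IsProbabilityMeasure μ]
    (y' : StrongDual ℝ E) (r : ℝ) : ‖shotCharFun α μ y' r‖ ≤ 1 := by
  refine (norm_integral_le_integral_norm _).trans ?_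
  simp

variable [BorelSpace E] [SecondCountableTopology E]

/-- By independence the joint law of arrival times and marks is a product, so Fubini reduces the
claim to frozen arrival times. -/
theorem IsSymmetricShot.ae_exists_tendsto (h : IsSymmetricShot α Γ V P) (hα0 : 0 < α) (hα2 : α < 2)
    (y' : StrongDual ℝ E) :
    ∀ᵐ ω ∂P, ∃ l, Tendsto (fun N => y' (shotPartialSum α Γ V N ω)) atTop (𝓝 l) := by
  have hΓm : Measurable fun ω n => Γ n ω := measurable_pi_lambda _ h.arrival.measurable
  have hVm : Measurable fun ω n => V n ω := measurable_pi_lambda _ h.measurable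
  have hy := y'.continuous.measurable
  have : IsProbabilityMeasure (P.map fun ω n => V n ω) :=
    Measure.isProbabilityMeasure_map hVm.aemeasurable
  let A : Set ((ℕ → ℝ) × (ℕ → E)) := {p | ∃ l, Tendsto
    (fun N => ∑ n ∈ Finset.range N, y' (shotKernel α (p.1 n) (p.2 n))) atTop (𝓝 l)}
  have hA : MeasurableSet A := by
    refine measurableSet_exists_tendsto fun N => Finset.measurable_sum _ fun n _ => ?_
    have h1 : Measurable fun p : (ℕ → ℝ) × (ℕ → E) => (p.1 n, p.2 n) := by fun_prop
    exact hy.comp ((measurable_shotKernel α).comp h1)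
  have hmem : ∀ᵐ p ∂(P.map fun ω n => Γ n ω).prod (P.map fun ω n => V n ω), p ∈ A := by
    rw [Measure.ae_prod_mem_iff_ae_ae_mem hA]
    have hB : MeasurableSet {γ : ℕ → ℝ | ∃ k : ℕ, ∀ n : ℕ, ((n : ℝ) + 1) / (k + 1) ≤ γ n} := by
      simp only [Set.ofPred_exists, Set.ofPred_forall]
      exact MeasurableSet.iUnion fun k => MeasurableSet.iInter fun n =>
        measurableSet_le measurable_const (measurable_pi_apply n)
    have h1 := (ae_map_iff hΓm.aemeasurable hB).2 h.arrival.ae_exists_le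
    filter_upwards [h1] with γ ⟨k, hk⟩
    refine (ae_map_iff hVm.aemeasurable (measurable_prodMk_left hA)).2 ?_
    exact ae_exists_tendsto_sum_shotKernel hα0 hα2 h.measurable h.iIndepFun h.map_eq h.map_neg
      h.moment y' (c := 1 / ((k : ℝ) + 1)) (by positivity)
      fun n => (by ring : 1 / ((k : ℝ) + 1) * (n + 1) = ((n : ℝ) + 1) / (k + 1)).trans_le (hk n)
  rw [← h.map_prodMk] at hmem
  filter_upwards [(ae_map_iff (hΓm.prodMk hVm).aemeasurable hA).1 hmem] with ω ⟨l, hl⟩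
  exact ⟨l, by simpa [shotPartialSum] using hl⟩

theorem measurable_exp_shotKernel (α : ℝ) (y' : StrongDual ℝ E) :
    Measurable fun p : ℝ × E => Complex.exp (Complex.I * (y' (shotKernel α p.1 p.2) : ℂ)) := by
  have hy := y'.continuous.measurable.comp (measurable_shotKernel (E := E) α)
  exact Complex.measurable_exp.comp ((Complex.measurable_ofReal.comp hy).const_mul _)

theorem measurable_shotCharFun (α : ℝ) (μ : Measure E) [SFinite μ] (y' : StrongDual ℝ E) :
    Measurable (shotCharFun α μ y') :=
  ((measurable_exp_shotKernel α y').stronglyMeasurable.integral_prod_right).measurable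

theorem continuousOn_shotCharFun (α : ℝ) (μ : Measure E) [IsProbabilityMeasure μ]
    (y' : StrongDual ℝ E) : ContinuousOn (shotCharFun α μ y') (Set.Ioi 0) := by
  refine continuousOn_of_dominated (bound := fun _ => 1) (fun r _ => ?_) (fun r _ => ?_)
    (integrable_const _) (ae_of_all _ fun v => ?_)
  · exact ((measurable_exp_shotKernel α y').comp measurable_prodMk_left).aestronglyMeasurable
  · exact ae_of_all _ fun v => (norm_exp_I_mul_ofReal _).le
  · unfold shotKernel
    have : ContinuousOn (fun r : ℝ => r ^ (-1 / α)) (Set.Ioi 0) := fun r hr =>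
      (Real.continuousAt_rpow_const r _ (Or.inl (ne_of_gt hr))).continuousWithinAt
    fun_prop

/-- The compensator is bounded and odd in v, so it integrates to 0 against a symmetric law. This is
done for fixed r because the compensator alone need not be integrable in r. -/
theorem integral_levyKhintchineIntegrand_eq {μ : Measure E} [IsProbabilityMeasure μ]
    (hneg : μ.map (fun v => -v) = μ) (y' : StrongDual ℝ E) (r : ℝ) :
    ∫ v, levyKhintchineIntegrand y' (shotKernel α r v) ∂μ = shotCharFun α μ y' r - 1 := by
  have hk : Measurable fun v : E => shotKernel α r v :=
    (measurable_shotKernel α).comp measurable_prodMk_left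
  have hy := y'.continuous.measurable
  let J : E → ℂ := Set.indicator {z : E | ‖z‖ ≤ 1} fun z => Complex.I * (y' z : ℂ)
  have hJm : Measurable J :=
    (by fun_prop : Measurable fun z => Complex.I * (y' z : ℂ)).indicator
      (measurableSet_le measurable_norm measurable_const)
  have hJb : ∀ z, ‖J z‖ ≤ ‖y'‖ := by
    intro z
    by_cases hz : ‖z‖ ≤ 1
    · simp only [J]
      rw [Set.indicator_of_mem (by exact hz)]
      simpa using y'.le_of_opNorm_le_of_le le_rfl hz
    · simp only [J]
      rw [Set.indicator_of_notMem (by exact hz)]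
      simp
  have hJn : ∀ z, J (-z) = - J z := by
    intro z
    by_cases hz : ‖z‖ ≤ 1 <;> simp [J, hz]
  have hJi : Integrable (fun v => J (shotKernel α r v)) μ :=
    Integrable.of_bound (hJm.comp hk).aestronglyMeasurable ‖y'‖ (ae_of_all _ fun v => hJb _)
  have hJ0 : ∫ v, J (shotKernel α r v) ∂μ = 0 := by
    have h1 : ∫ v, J (shotKernel α r v) ∂μ = - ∫ v, J (shotKernel α r v) ∂μ := by
      conv_lhs => rw [← hneg]
      have hJk : Measurable fun v => J (shotKernel α r v) := hJm.comp hk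
      rw [integral_map measurable_neg.aemeasurable hJk.aestronglyMeasurable, ← integral_neg]
      refine integral_congr_ae (ae_of_all _ fun v => ?_)
      simp only [shotKernel, smul_neg, hJn]
    exact self_eq_neg.1 h1
  have hei : Integrable (fun v => Complex.exp (Complex.I * (y' (shotKernel α r v) : ℂ))) μ :=
    Integrable.of_bound
      ((measurable_exp_shotKernel α y').comp measurable_prodMk_left).aestronglyMeasurable 1
      (ae_of_all _ fun v => (norm_exp_I_mul_ofReal _).le)
  change ∫ v, (Complex.exp (Complex.I * (y' (shotKernel α r v) : ℂ)) - 1 -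
    J (shotKernel α r v)) ∂μ = _
  have hei1 : Integrable (fun v => Complex.exp (Complex.I * (y' (shotKernel α r v) : ℂ)) - 1) μ :=
    hei.sub (integrable_const _)
  rw [integral_sub hei1 hJi, hJ0, sub_zero, integral_sub hei (integrable_const _)]
  simp [shotCharFun]

theorem integrableOn_one_sub_shotCharFun (hα0 : 0 < α) (hα2 : α < 2)
    {μ : Measure E} [IsProbabilityMeasure μ] (hμ : ∫⁻ v, ‖v‖ₑ ^ α ∂μ ≠ ∞)
    (hneg : μ.map (fun v => -v) = μ) (y' : StrongDual ℝ E) :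
    IntegrableOn (fun r => 1 - shotCharFun α μ y' r) (Set.Ioi 0) := by
  have h := (integrable_levyKhintchineIntegrand_shotKernel hα0 hα2 hμ y').integral_prod_left.neg
  refine h.congr (ae_of_all _ fun r => ?_)
  simp only [Pi.neg_apply]
  rw [integral_levyKhintchineIntegrand_eq hneg, neg_sub]

theorem integral_prod_levyKhintchineIntegrand_eq (hα0 : 0 < α) (hα2 : α < 2)
    {μ : Measure E} [IsProbabilityMeasure μ] (hμ : ∫⁻ v, ‖v‖ₑ ^ α ∂μ ≠ ∞)
    (hneg : μ.map (fun v => -v) = μ) (y' : StrongDual ℝ E) :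
    ∫ p : ℝ × E, levyKhintchineIntegrand y' (shotKernel α p.1 p.2)
      ∂((volume.restrict (Set.Ioi 0)).prod μ) =
      -∫ r in Set.Ioi 0, (1 - shotCharFun α μ y' r) := by
  rw [integral_prod _ (integrable_levyKhintchineIntegrand_shotKernel hα0 hα2 hμ y'),
    ← integral_neg]
  refine integral_congr_ae (ae_of_all _ fun r => ?_)
  simp only []
  rw [integral_levyKhintchineIntegrand_eq hneg, neg_sub]

/-- With the arrival times fixed by Fubini, independence of the marks factors the exponential, and
each factor is integrated against the common law. -/
theorem IsSymmetricShot.integral_exp_eq (h : IsSymmetricShot α Γ V P) (y' : StrongDual ℝ E)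
    (N : ℕ) :
    ∫ ω, Complex.exp (Complex.I * (y' (shotPartialSum α Γ V N ω) : ℂ)) ∂P =
      ∫ ω, ∏ n ∈ Finset.range N, shotCharFun α (P.map (V 0)) y' (Γ n ω) ∂P := by
  have hΓm : Measurable fun ω n => Γ n ω := measurable_pi_lambda _ h.arrival.measurable
  have hVm : Measurable fun ω n => V n ω := measurable_pi_lambda _ h.measurable
  have : IsProbabilityMeasure (P.map fun ω n => Γ n ω) :=
    Measure.isProbabilityMeasure_map hΓm.aemeasurable
  have : IsProbabilityMeasure (P.map fun ω n => V n ω) :=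
    Measure.isProbabilityMeasure_map hVm.aemeasurable
  let e : ℝ × E → ℂ := fun p => Complex.exp (Complex.I * (y' (shotKernel α p.1 p.2) : ℂ))
  have hem : Measurable e := measurable_exp_shotKernel α y'
  let F : (ℕ → ℝ) × (ℕ → E) → ℂ := fun p => ∏ n ∈ Finset.range N, e (p.1 n, p.2 n)
  have hFm : Measurable F := by fun_prop
  have hFi : Integrable F ((P.map fun ω n => Γ n ω).prod (P.map fun ω n => V n ω)) := by
    refine Integrable.of_bound hFm.aestronglyMeasurable 1 (ae_of_all _ fun p => ?_)
    rw [norm_prod]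
    exact Finset.prod_le_one (fun _ _ => norm_nonneg _) fun _ _ => (norm_exp_I_mul_ofReal _).le
  have hgm : Measurable (shotCharFun α (P.map (V 0)) y') := by
    have : IsProbabilityMeasure (P.map (V 0)) :=
      Measure.isProbabilityMeasure_map (h.measurable 0).aemeasurable
    exact measurable_shotCharFun _ _ _
  calc _ = ∫ ω, F ((fun n => Γ n ω), fun n => V n ω) ∂P := by
        refine integral_congr_ae (ae_of_all _ fun ω => ?_)
        simp only [F, e, shotPartialSum, map_sum, ← Complex.exp_sum, Finset.mul_sum,
          Complex.ofReal_sum]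
    _ = ∫ γ, ∫ v, F (γ, v) ∂(P.map fun ω n => V n ω) ∂(P.map fun ω n => Γ n ω) := by
        rw [← integral_prod _ hFi, ← h.map_prodMk,
          integral_map (hΓm.prodMk hVm).aemeasurable hFm.aestronglyMeasurable]
    _ = ∫ γ, ∏ n ∈ Finset.range N, shotCharFun α (P.map (V 0)) y' (γ n)
          ∂(P.map fun ω n => Γ n ω) := by
        refine integral_congr_ae (ae_of_all _ fun γ => ?_)
        simp only []
        have hFγ : Measurable fun v => F (γ, v) := hFm.comp measurable_prodMk_left
        rw [integral_map hVm.aemeasurable hFγ.aestronglyMeasurable]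
        simp only [F]
        have hek : ∀ n, Measurable fun v => e (γ n, v) := fun n => hem.comp measurable_prodMk_left
        have h1 := ((h.iIndepFun.comp (fun n v => e (γ n, v)) hek).precomp
          (g := fun i : Finset.range N => (i : ℕ)) Subtype.val_injective
          ).integral_fun_prod_eq_prod_integral
            fun i => ((hek i).comp (h.measurable i)).aestronglyMeasurable
        simp only [Function.comp] at h1
        rw [← Finset.prod_coe_sort (Finset.range N) fun n =>
          shotCharFun α (P.map (V 0)) y' (γ n)]
        refine (integral_congr_ae (ae_of_all _ fun ω => ?_)).trans (h1.trans ?_)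
        · exact (Finset.prod_coe_sort (Finset.range N) fun n => e (γ n, V n ω)).symm
        · refine Finset.prod_congr rfl fun i _ => ?_
          rw [shotCharFun, ← h.map_eq i, integral_map (h.measurable i).aemeasurable
            (hek i).aestronglyMeasurable]
    _ = _ := by
        rw [integral_map hΓm.aemeasurable (Measurable.aestronglyMeasurable (by fun_prop))]

theorem IsSymmetricShot.tendsto_integral_exp (h : IsSymmetricShot α Γ V P) (hα0 : 0 < α)
    (hα2 : α < 2) (y' : StrongDual ℝ E) :
    Tendsto (fun N => ∫ ω, Complex.exp (Complex.I * (y' (shotPartialSum α Γ V N ω) : ℂ)) ∂P)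
      atTop (𝓝 (Complex.exp (∫ p : ℝ × E, levyKhintchineIntegrand y' (shotKernel α p.1 p.2)
      ∂((volume.restrict (Set.Ioi 0)).prod (P.map (V 0)))))) := by
  have : IsProbabilityMeasure (P.map (V 0)) :=
    Measure.isProbabilityMeasure_map (h.measurable 0).aemeasurable
  obtain ⟨ξ, hm, hlaw, hind, hΓ⟩ := h.arrival
  rw [integral_prod_levyKhintchineIntegrand_eq hα0 hα2 h.moment h.map_neg]
  refine (tendsto_integral_prod_arrival hm hlaw hind (measurable_shotCharFun _ _ _)
    (continuousOn_shotCharFun _ _ _) (norm_shotCharFun_le _ _ _)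
    (integrableOn_one_sub_shotCharFun hα0 hα2 h.moment h.map_neg y')).congr fun N => ?_
  rw [h.integral_exp_eq]
  simp only [hΓ]

end ShotSeries

/-! ### Uniform convergence in probability by symmetry -/

/-- On a compact set of functions, smallness of the norm is controlled by finitely many values. -/
theorem IsCompact.exists_finset_lt_abs_apply {X : Type*} [TopologicalSpace X] [CompactSpace X]
    {C : Set C(X, ℝ)} (hC : IsCompact C) {δ : ℝ} (hδ : 0 < δ) :
    ∃ s : Finset (X × ℕ), ∀ z ∈ C, δ ≤ ‖z‖ → ∃ p ∈ s, 1 / ((p.2 : ℝ) + 1) < |z p.1| := by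
  -- This compact set omits 0, so the open conditions |z x| > 1/(k + 1) cover it.
  have hS : IsCompact (C ∩ {z | δ ≤ ‖z‖}) :=
    hC.inter_right (isClosed_le continuous_const continuous_norm)
  obtain ⟨s, hs⟩ := hS.elim_finite_subcover
    (fun p : X × ℕ => {z : C(X, ℝ) | 1 / ((p.2 : ℝ) + 1) < |z p.1|})
    (fun p => isOpen_lt continuous_const (by fun_prop)) (by
      rintro z ⟨-, hz⟩
      have hz0 : z ≠ 0 := by
        rintro rfl
        simp at hz
        linarith
      obtain ⟨x, hx⟩ := DFunLike.ne_iff.1 hz0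
      obtain ⟨k, hk⟩ := exists_nat_one_div_lt (abs_pos.2 hx)
      exact Set.mem_iUnion.2 ⟨(x, k), hk⟩)
  refine ⟨s, fun z hz h => ?_⟩
  simpa using hs ⟨hz, h⟩

section

variable {Ω : Type*} [MeasurableSpace Ω] {P : Measure Ω} [IsProbabilityMeasure P]
  {K : Compacts ℝ≥0} [MeasurableSpace C(K, ℝ)] [BorelSpace C(K, ℝ)]
  {α : ℝ} {Γ : ℕ → Ω → ℝ} {V : ℕ → Ω → C(K, ℝ)} {Y : Ω → C(K, ℝ)}

/-- Each mark is symmetric and independent of the other marks and of the arrival times, so signs may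
be changed beyond any index without affecting the joint law. -/
theorem IsSymmetricShot.map_flip (h : IsSymmetricShot α Γ V P) (N : ℕ) :
    P.map (fun ω => ((fun n => Γ n ω), fun n => if n < N then V n ω else - V n ω)) =
      P.map (fun ω => ((fun n => Γ n ω), fun n => V n ω)) := by
  let φ : ℕ → C(K, ℝ) → C(K, ℝ) := fun n v => if n < N then v else -v
  have hφ : ∀ n, Measurable (φ n) := fun n => by
    by_cases hn : n < N
    · simpa [φ, hn] using measurable_id'
    · simpa [φ, hn] using measurable_neg
  have hΓm : Measurable fun ω n => Γ n ω := measurable_pi_lambda _ h.arrival.measurable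
  have hVm : Measurable fun ω n => V n ω := measurable_pi_lambda _ h.measurable
  have hφm : Measurable fun (v : ℕ → C(K, ℝ)) n => φ n (v n) :=
    measurable_pi_lambda _ fun n => (hφ n).comp (measurable_pi_apply n)
  have hfl : P.map (fun ω n => φ n (V n ω)) = P.map fun ω n => V n ω := by
    have h1 := (h.iIndepFun.comp φ hφ).map_fun_eq_infinitePi_map
      fun n => (hφ n).comp (h.measurable n)
    refine h1.trans ?_
    rw [h.iIndepFun.map_fun_eq_infinitePi_map h.measurable]
    congr 1
    ext1 n
    rw [← Measure.map_map (hφ n) (h.measurable n)]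
    by_cases hn : n < N
    · simp [φ, hn]
    · simp only [φ, hn, if_false]
      rw [h.map_eq n, h.map_neg]
  have hind : IndepFun (fun ω n => Γ n ω) (fun ω n => φ n (V n ω)) P :=
    h.indepFun.comp measurable_id hφm
  rw [h.map_prodMk, ← hfl]
  exact (indepFun_iff_map_prod_eq_prod_map_map hΓm.aemeasurable
    (hφm.comp hVm).aemeasurable).1 hind

/-- Flipping the marks from index N on replaces the tail Y - S_N by its opposite, hence Y by 2S_N -
Y, and preserves the joint law. -/
theorem IsSymmetricShot.map_two_smul_sub (h : IsSymmetricShot α Γ V P)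
    (hY : IsShotSeries α Γ V Y P) (N : ℕ) :
    P.map (fun ω => (2 : ℝ) • shotPartialSum α Γ V N ω - Y ω) = P.map Y := by
  obtain ⟨D, hDc, hDd⟩ := TopologicalSpace.exists_countable_dense K
  have : Countable D := hDc
  have hE := ContinuousMap.measurableEmbedding_restrict hDc hDd
  refine hE.map_injective ?_
  have hΓm : Measurable fun ω n => Γ n ω := measurable_pi_lambda _ h.arrival.measurable
  have hVm : Measurable fun ω n => V n ω := measurable_pi_lambda _ h.measurable
  have hSm : ∀ N, Measurable fun p : (ℕ → ℝ) × (ℕ → C(K, ℝ)) =>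
      ∑ n ∈ Finset.range N, shotKernel α (p.1 n) (p.2 n) := by
    intro N
    refine Finset.measurable_sum _ fun n _ => ?_
    exact (measurable_shotKernel α).comp (by fun_prop : Measurable
      fun p : (ℕ → ℝ) × (ℕ → C(K, ℝ)) => (p.1 n, p.2 n))
  have hYm := hY.aemeasurable
  have hY'm : AEMeasurable (fun ω => (2 : ℝ) • shotPartialSum α Γ V N ω - Y ω) P :=
    (((hSm N).comp (hΓm.prodMk hVm)).const_smul (2 : ℝ)).aemeasurable.sub hYm
  rw [AEMeasurable.map_map_of_aemeasurable hE.measurable.aemeasurable hYm,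
    AEMeasurable.map_map_of_aemeasurable hE.measurable.aemeasurable hY'm]
  -- The limsup is measurable everywhere, whatever its value where the series diverges, and makes Y
  -- on D one functional of arrival times and marks.
  let L : (ℕ → ℝ) × (ℕ → C(K, ℝ)) → D → ℝ := fun p d => limsup
    (fun M => (∑ n ∈ Finset.range M, shotKernel α (p.1 n) (p.2 n)) d) atTop
  have hLm : Measurable L := by
    refine measurable_pi_lambda _ fun d => Measurable.limsup fun M => ?_
    exact (continuous_eval_const (d : K)).measurable.comp (hSm M)
  have hflm : Measurable fun ω =>
      ((fun n => Γ n ω), fun n => if n < N then V n ω else - V n ω) := by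
    refine hΓm.prodMk (measurable_pi_lambda _ fun n => ?_)
    by_cases hn : n < N
    · simpa only [hn, if_true] using h.measurable n
    · simp only [hn, if_false]
      exact (h.measurable n).neg
  have hconv : ∀ᵐ ω ∂P, ∀ d : D, Tendsto (fun M => shotPartialSum α Γ V M ω (d : K)) atTop
      (𝓝 (Y ω d)) := ae_all_iff.2 fun d => hY.tendsto d
  have h1 : (fun (f : C(K, ℝ)) (d : D) => f d) ∘ Y =ᵐ[P]
      fun ω => L ((fun n => Γ n ω), fun n => V n ω) := by
    filter_upwards [hconv] with ω hω
    ext d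
    exact (hω d).limsup_eq.symm
  have h2 : (fun (f : C(K, ℝ)) (d : D) => f d) ∘
      (fun ω => (2 : ℝ) • shotPartialSum α Γ V N ω - Y ω) =ᵐ[P]
      fun ω => L ((fun n => Γ n ω), fun n => if n < N then V n ω else - V n ω) := by
    filter_upwards [hconv] with ω hω
    ext d
    refine (Tendsto.limsup_eq ?_).symm
    have h3 := (hω d).const_sub (2 * shotPartialSum α Γ V N ω d)
    refine h3.congr' ?_
    filter_upwards [eventually_ge_atTop N] with M hM
    obtain ⟨m, rfl⟩ := Nat.exists_eq_add_of_le hM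
    have hlt : ∀ n ∈ Finset.range N, shotKernel α (Γ n ω)
        (if n < N then V n ω else - V n ω) = shotKernel α (Γ n ω) (V n ω) := by
      intro n hn
      rw [if_pos (Finset.mem_range.1 hn)]
    simp only [shotPartialSum, Finset.sum_range_add, Finset.sum_congr rfl hlt]
    simp [shotKernel]
    ring
  rw [Measure.map_congr h1, Measure.map_congr h2,
    ← Function.comp_def L, ← Measure.map_map hLm hflm, h.map_flip N,
    Measure.map_map hLm (hΓm.prodMk hVm)]
  rfl

/-- The partial sums of a symmetric shot series converge in probability, for the uniform norm. -/
theorem IsSymmetricShot.tendsto_measure_norm_sub (h : IsSymmetricShot α Γ V P)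
    (hY : IsShotSeries α Γ V Y P) {δ : ℝ} (hδ : 0 < δ) :
    Tendsto (fun N => P {ω | δ ≤ ‖shotPartialSum α Γ V N ω - Y ω‖}) atTop (𝓝 0) := by
  have hSm : ∀ N, Measurable fun ω => shotPartialSum α Γ V N ω := by
    intro N
    refine Finset.measurable_sum _ fun n _ => ?_
    exact (measurable_shotKernel α).comp ((h.arrival.measurable n).prodMk (h.measurable n))
  have hYm := hY.aemeasurable
  have : IsProbabilityMeasure (P.map Y) := Measure.isProbabilityMeasure_map hYm
  have htight : IsTightMeasureSet {P.map Y} := isTightMeasureSet_singleton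
  rw [isTightMeasureSet_iff_exists_isCompact_measure_compl_le] at htight
  rw [ENNReal.tendsto_atTop_zero]
  intro ε hε
  have hε3 : 0 < ε / 3 := ENNReal.div_pos hε.ne' (by norm_num)
  obtain ⟨C, hC, hCε⟩ := htight (ε / 3) hε3
  have hCε := hCε _ rfl
  -- S_N - Y is half of (2S_N - Y) - Y, and both terms have the law of Y, so each leaves C with
  -- probability at most ε/3. The last third is for the finitely many evaluations.
  let C' : Set C(K, ℝ) := (fun p : C(K, ℝ) × C(K, ℝ) => (1 / 2 : ℝ) • (p.1 - p.2)) '' (C ×ˢ C)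
  have hC' : IsCompact C' := (hC.prod hC).image (by fun_prop)
  obtain ⟨s, hs⟩ := hC'.exists_finset_lt_abs_apply hδ
  have hsum : Tendsto (fun N => ∑ p ∈ s,
      P {ω | 1 / ((p.2 : ℝ) + 1) ≤ ‖shotPartialSum α Γ V N ω p.1 - Y ω p.1‖}) atTop (𝓝 0) := by
    rw [← Finset.sum_const_zero (s := s)]
    refine tendsto_finsetSum _ fun p _ => ?_
    have hev : Measurable fun f : C(K, ℝ) => f p.1 :=
      (continuous_eval_const p.1).measurable
    have h1 := tendstoInMeasure_of_tendsto_ae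
      (fun N => (hev.comp (hSm N)).aestronglyMeasurable) (hY.tendsto p.1)
    rw [tendstoInMeasure_iff_norm] at h1
    exact h1 _ (by positivity)
  obtain ⟨N₀, hN₀⟩ := ENNReal.tendsto_atTop_zero.1 hsum (ε / 3) hε3
  refine ⟨N₀, fun N hN => ?_⟩
  have hY'm : AEMeasurable (fun ω => (2 : ℝ) • shotPartialSum α Γ V N ω - Y ω) P :=
    ((hSm N).const_smul (2 : ℝ)).aemeasurable.sub hYm
  have hsub : {ω | δ ≤ ‖shotPartialSum α Γ V N ω - Y ω‖} ⊆
      (Y ⁻¹' Cᶜ ∪ (fun ω => (2 : ℝ) • shotPartialSum α Γ V N ω - Y ω) ⁻¹' Cᶜ) ∪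
      ⋃ p ∈ s, {ω | 1 / ((p.2 : ℝ) + 1) ≤ ‖shotPartialSum α Γ V N ω p.1 - Y ω p.1‖} := by
    intro ω hω
    by_contra hcon
    simp only [Set.mem_union, Set.mem_preimage, Set.mem_compl_iff, not_or, not_not] at hcon
    obtain ⟨⟨ha, hb⟩, hc⟩ := hcon
    have hmem : shotPartialSum α Γ V N ω - Y ω ∈ C' := by
      refine ⟨(_, _), ⟨hb, ha⟩, ?_⟩
      simp only []
      module
    obtain ⟨p, hp, hlt⟩ := hs _ hmem hω
    refine hc (Set.mem_iUnion₂.2 ⟨p, hp, ?_⟩)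
    exact hlt.le
  have hCm : MeasurableSet Cᶜ := hC.isClosed.measurableSet.compl
  calc _ ≤ (P (Y ⁻¹' Cᶜ) + P ((fun ω => (2 : ℝ) • shotPartialSum α Γ V N ω - Y ω) ⁻¹' Cᶜ)) +
        ∑ p ∈ s, P {ω | 1 / ((p.2 : ℝ) + 1) ≤ ‖shotPartialSum α Γ V N ω p.1 - Y ω p.1‖} := by
        refine (measure_mono hsub).trans ((measure_union_le _ _).trans ?_)
        exact add_le_add (measure_union_le _ _) (measure_biUnion_finset_le _ _)
    _ ≤ (ε / 3 + ε / 3) + ε / 3 := by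
        refine add_le_add (add_le_add ?_ ?_) (hN₀ N hN)
        · rwa [← Measure.map_apply_of_aemeasurable hYm hCm]
        · rwa [← Measure.map_apply_of_aemeasurable hY'm hCm, h.map_two_smul_sub hY N]
    _ = ε := ENNReal.add_thirds ε

/-- Convergence in probability gives almost sure convergence along a subsequence. This suffices, as
`IsSymmetricShot.tendsto_integral_exp` gives the limit of the full sequence. -/
theorem IsSymmetricShot.tendsto_subseq_integral_exp (h : IsSymmetricShot α Γ V P)
    (hY : IsShotSeries α Γ V Y P) (y' : StrongDual ℝ C(K, ℝ)) :
    ∃ ns : ℕ → ℕ, StrictMono ns ∧ Tendsto (fun i => ∫ ω, Complex.exp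
      (Complex.I * (y' (shotPartialSum α Γ V (ns i) ω) : ℂ)) ∂P) atTop
      (𝓝 (∫ ω, Complex.exp (Complex.I * (y' (Y ω) : ℂ)) ∂P)) := by
  have hSm : ∀ N, Measurable fun ω => shotPartialSum α Γ V N ω := by
    intro N
    refine Finset.measurable_sum _ fun n _ => ?_
    exact (measurable_shotKernel α).comp ((h.arrival.measurable n).prodMk (h.measurable n))
  have hy := y'.continuous.measurable
  have hT : TendstoInMeasure P (fun N ω => shotPartialSum α Γ V N ω) atTop Y :=
    tendstoInMeasure_iff_norm.2 fun δ hδ => h.tendsto_measure_norm_sub hY hδ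
  obtain ⟨ns, hns, hlim⟩ := hT.exists_seq_tendsto_ae
  refine ⟨ns, hns, tendsto_integral_of_dominated_convergence (fun _ => 1) (fun i => ?_)
    (integrable_const _) (fun i => ae_of_all _ fun ω => (norm_exp_I_mul_ofReal _).le) ?_⟩
  · have h1 : Measurable fun ω => y' (shotPartialSum α Γ V (ns i) ω) := hy.comp (hSm _)
    exact Measurable.aestronglyMeasurable (by fun_prop)
  · filter_upwards [hlim] with ω hω
    have hc : Continuous fun y : C(K, ℝ) => Complex.exp (Complex.I * (y' y : ℂ)) := by fun_prop
    exact (hc.tendsto _).comp hω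

end

/-! ### Measurability and moments of the marks -/

/-- Two independent sequences of independent variables combine into a sequence of independent
pairs. -/
theorem ProbabilityTheory.iIndepFun.prodMk_of_indepFun {Ω ι β γ : Type*} [MeasurableSpace Ω]
    [MeasurableSpace β] [MeasurableSpace γ] {P : Measure Ω} {A : ι → Ω → β} {B : ι → Ω → γ}
    (hAm : ∀ i, Measurable (A i)) (hBm : ∀ i, Measurable (B i))
    (hA : iIndepFun A P) (hB : iIndepFun B P)
    (hAB : IndepFun (fun ω i => A i ω) (fun ω i => B i ω) P) :
    iIndepFun (fun i ω => (A i ω, B i ω)) P := by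
  have hABm : ∀ i, Measurable fun ω => (A i ω, B i ω) := fun i => (hAm i).prodMk (hBm i)
  refine (iIndepFun_iff_iIndep _ _ _).2 (iIndepSets.iIndep (fun i => (hABm i).comap_le)
    (fun i => Set.preimage (fun ω => (A i ω, B i ω)) ''
      Set.image2 (· ×ˢ ·) {s | MeasurableSet s} {t | MeasurableSet t})
    (fun i => ?_) (fun i => ?_) ?_)
  · have h := (isPiSystem_prod (α := β) (β := γ)).comap fun ω => (A i ω, B i ω)
    simpa [Set.image] using h
  · rw [← generateFrom_prod, MeasurableSpace.comap_generateFrom]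
  · rw [iIndepSets_iff]
    intro s f hf
    choose! U hU hUf using hf
    choose! S hS T hT hST using hU
    have hpre : ∀ i ∈ s, f i = A i ⁻¹' S i ∩ B i ⁻¹' T i := by
      intro i hi
      rw [← hUf i hi, ← hST i hi]
      rfl
    have h1 : P ((⋂ i ∈ s, A i ⁻¹' S i) ∩ ⋂ i ∈ s, B i ⁻¹' T i) =
        P (⋂ i ∈ s, A i ⁻¹' S i) * P (⋂ i ∈ s, B i ⁻¹' T i) := by
      have h2 := hAB.measure_inter_preimage_eq_mul (s := {a | ∀ i ∈ s, a i ∈ S i})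
        (t := {b | ∀ i ∈ s, b i ∈ T i}) ?_ ?_
      · have e1 : (fun ω i => A i ω) ⁻¹' {a | ∀ i ∈ s, a i ∈ S i} = ⋂ i ∈ s, A i ⁻¹' S i := by
          ext; simp
        have e2 : (fun ω i => B i ω) ⁻¹' {a | ∀ i ∈ s, a i ∈ T i} = ⋂ i ∈ s, B i ⁻¹' T i := by
          ext; simp
        rwa [e1, e2] at h2
      · exact MeasurableSet.pi s.countable_toSet fun i hi => hS i hi
      · exact MeasurableSet.pi s.countable_toSet fun i hi => hT i hi
    have h3 : ⋂ i ∈ s, f i = (⋂ i ∈ s, A i ⁻¹' S i) ∩ ⋂ i ∈ s, B i ⁻¹' T i := by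
      rw [Set.iInter₂_congr hpre]
      ext
      simp [forall_and]
    rw [h3, h1, hA.measure_inter_preimage_eq_mul s hS, hB.measure_inter_preimage_eq_mul s hT,
      ← Finset.prod_mul_distrib]
    refine Finset.prod_congr rfl fun i hi => ?_
    rw [hpre i hi]
    exact ((hAB.comp (measurable_pi_apply i) (measurable_pi_apply i)
      ).measure_inter_preimage_eq_mul _ _ (hS i hi) (hT i hi)).symm

/-- The map `(g, x, u) ↦ g φ(x) ^ (-1/α) u(x, ·)`. -/
noncomputable def markMap (K : Compacts ℝ≥0) (α : ℝ) (φ : ℝ → ℝ) (p : ℝ × ℝ × C(ℝ × ℝ≥0, ℝ)) :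
    C(K, ℝ) :=
  (p.1 * φ p.2.1 ^ (-1 / α)) • sectionOn K p.2.2 p.2.1

section Evaluation

variable [mC : MeasurableSpace C(ℝ × ℝ≥0, ℝ)]

theorem measurable_of_eq_comap_eval
    (hC : mC = MeasurableSpace.comap (fun u p => u p) MeasurableSpace.pi)
    {Ω : Type*} [MeasurableSpace Ω] {f : Ω → C(ℝ × ℝ≥0, ℝ)}
    (hf : ∀ p, Measurable fun ω => f ω p) : Measurable f := by
  subst hC
  exact measurable_comap_iff.2 (measurable_pi_lambda _ hf)

theorem measurable_eval_apply
    (hC : mC = MeasurableSpace.comap (fun u p => u p) MeasurableSpace.pi) (p : ℝ × ℝ≥0) :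
    Measurable fun u : C(ℝ × ℝ≥0, ℝ) => u p := by
  subst hC
  exact (measurable_pi_apply p).comp (comap_measurable _)

/-- For each t, evaluation is continuous in x and measurable in u, hence jointly measurable;
evaluations determine measurability in C(K). -/
theorem measurable_sectionOn {K : Compacts ℝ≥0} [MeasurableSpace C(K, ℝ)] [BorelSpace C(K, ℝ)]
    (hC : mC = MeasurableSpace.comap (fun u p => u p) MeasurableSpace.pi) :
    Measurable fun p : ℝ × C(ℝ × ℝ≥0, ℝ) => sectionOn K p.2 p.1 := by
  refine ContinuousMap.measurable_of_eval fun t => ?_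
  exact measurable_uncurry_of_continuous_of_measurable
    (u := fun (x : ℝ) (u : C(ℝ × ℝ≥0, ℝ)) => u (x, (t : ℝ≥0)))
    (fun u => by fun_prop) fun x => measurable_eval_apply hC _

theorem measurable_markMap {K : Compacts ℝ≥0} [MeasurableSpace C(K, ℝ)] [BorelSpace C(K, ℝ)]
    (hC : mC = MeasurableSpace.comap (fun u p => u p) MeasurableSpace.pi)
    {φ : ℝ → ℝ} (hφ : Measurable φ) (α : ℝ) : Measurable (markMap K α φ) := by
  have h := (measurable_sectionOn (K := K) hC).comp
    (measurable_snd : Measurable (Prod.snd : ℝ × ℝ × C(ℝ × ℝ≥0, ℝ) → _))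
  have h1 : Measurable fun p : ℝ × ℝ × C(ℝ × ℝ≥0, ℝ) => p.1 * φ p.2.1 ^ (-1 / α) := by fun_prop
  exact h1.smul h

end Evaluation

/-- The choice is R = 1 + ρ + S with S dominating |B| up to time T. The summand 1 prepares the
comparison with the integrable weight (1 + |x|)^(-2). -/
theorem ProbabilityTheory.IsGaussianProcess.exists_ae_mem_enlargedRange {Ω : Type*}
    [MeasurableSpace Ω] {P : Measure Ω} {B : ℝ≥0 → Ω → ℝ} (hB : IsGaussianProcess B P)
    (h0 : ∀ t, ∫ ω, B t ω ∂P = 0) (hc : ∀ᵐ ω ∂P, Continuous fun t => B t ω) (T : ℝ≥0)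
    {ρ : ℝ} (hρ : 0 ≤ ρ) :
    ∃ R : Ω → ℝ, AEMeasurable R P ∧ ∫⁻ ω, ENNReal.ofReal (R ω ^ 4) ∂P ≠ ∞ ∧
      ∀ᵐ ω ∂P, ∀ t ≤ T, ∀ x ∈ enlargedRange (fun s => B s ω) ρ t, 1 + |x| ≤ R ω := by
  have := hB.isProbabilityMeasure
  obtain ⟨S, hS0, hS4, hSm, hS⟩ := hB.exists_integrable_sup_pow_four h0 hc T
  refine ⟨fun ω => (1 + ρ) + S ω, hSm.const_add _, ?_, ?_⟩
  · have hint : Integrable (fun ω => 2 ^ 3 * ((1 + ρ) ^ 4 + S ω ^ 4)) P :=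
      ((integrable_const _).add hS4).const_mul _
    refine ne_top_of_le_ne_top hint.lintegral_lt_top.ne (lintegral_mono fun ω => ?_)
    exact ENNReal.ofReal_le_ofReal (add_pow_le (by positivity) (hS0 ω) 4)
  · filter_upwards [hS] with ω hω t ht x hx
    have hb : ∀ s ∈ Set.Iic t, |B s ω| ≤ S ω := fun s hs => hω s (le_trans hs ht)
    have hne : ((fun s => B s ω) '' Set.Iic t).Nonempty := ⟨_, t, Set.mem_Iic.2 le_rfl, rfl⟩
    have h1 : sSup ((fun s => B s ω) '' Set.Iic t) ≤ S ω := by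
      refine csSup_le hne ?_
      rintro _ ⟨s, hs, rfl⟩
      exact (abs_le.1 (hb s hs)).2
    have h2 : -S ω ≤ sInf ((fun s => B s ω) '' Set.Iic t) := by
      refine le_csInf hne ?_
      rintro _ ⟨s, hs, rfl⟩
      exact (abs_le.1 (hb s hs)).1
    have h3 : |x| ≤ ρ + S ω := abs_le.2 ⟨by linarith [hx.1], by linarith [hx.2]⟩
    linarith

/-- If `u(x, ·)` vanishes outside a random interval with a finite fourth moment, then
`x ↦ E‖u(x, ·)‖ ^ α` is integrable. -/
theorem lintegral_lintegral_sectionOn_ne_top {Ω : Type*} [MeasurableSpace Ω] {P : Measure Ω}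
    {K : Compacts ℝ≥0} {α : ℝ} (hα : 0 < α) {u : Ω → C(ℝ × ℝ≥0, ℝ)} {R : Ω → ℝ} {T : ℝ≥0}
    (hT : ∀ t ∈ K, t ≤ T)
    (hRm : AEMeasurable R P) (hR : ∫⁻ ω, ENNReal.ofReal (R ω ^ 4) ∂P ≠ ∞)
    (hsupp : ∀ᵐ ω ∂P, ∀ t ≤ T, ∀ x, u ω (x, t) ≠ 0 → 1 + |x| ≤ R ω)
    {M : ℝ≥0} (hM : ∀ x, ∫⁻ ω, ‖sectionOn K (u ω) x‖ₑ ^ (2 * α) ∂P ≤ M) :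
    ∫⁻ x, ∫⁻ ω, ‖sectionOn K (u ω) x‖ₑ ^ α ∂P ≠ ∞ := by
  set C := ∫⁻ ω, ENNReal.ofReal (R ω ^ 4) ∂P
  -- Put a = ‖u(x, ·)‖^α. Where a is nonzero, 1 + |x| ≤ R, so (1 + |x|)² a ≤ R² a ≤ a² + R⁴; no
  -- independence of u and R is involved.
  have hb : ∀ x : ℝ, ∫⁻ ω, ‖sectionOn K (u ω) x‖ₑ ^ α ∂P ≤
      ENNReal.ofReal ((1 + ‖x‖) ^ (-2 : ℝ)) * (M + C) := by
    intro x
    calc _ ≤ ∫⁻ ω, ENNReal.ofReal ((1 + ‖x‖) ^ (-2 : ℝ)) *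
          (‖sectionOn K (u ω) x‖ₑ ^ (2 * α) + ENNReal.ofReal (R ω ^ 4)) ∂P := by
          refine lintegral_mono_ae ?_
          filter_upwards [hsupp] with ω hω
          set n := ‖sectionOn K (u ω) x‖ with hn
          have hn0 : 0 ≤ n := norm_nonneg _
          have he : ∀ q : ℝ, 0 ≤ q → ‖sectionOn K (u ω) x‖ₑ ^ q = ENNReal.ofReal (n ^ q) := by
            intro q hq
            rw [← ofReal_norm, ENNReal.ofReal_rpow_of_nonneg hn0 hq]
          rw [he α hα.le, he (2 * α) (by positivity), ← ENNReal.ofReal_add (by positivity)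
            (by positivity), ← ENNReal.ofReal_mul (by positivity)]
          refine ENNReal.ofReal_le_ofReal ?_
          rcases hn0.eq_or_lt with h0 | hpos
          · rw [← h0, Real.zero_rpow hα.ne']
            positivity
          · have hne : sectionOn K (u ω) x ≠ 0 := norm_pos_iff.1 hpos
            obtain ⟨t, ht⟩ := DFunLike.ne_iff.1 hne
            have hx : 1 + ‖x‖ ≤ R ω := hω t (hT t t.2) x ht
            have hx0 : 0 < 1 + ‖x‖ := by positivity
            have h2α : n ^ (2 * α) = (n ^ α) ^ 2 := by
              rw [mul_comm, Real.rpow_mul hn0, Real.rpow_two]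
            rw [h2α, Real.rpow_neg hx0.le, Real.rpow_two, inv_mul_eq_div,
              le_div_iff₀ (by positivity)]
            have h1 : (1 + ‖x‖) ^ 2 ≤ R ω ^ 2 := by gcongr
            have h2 : 0 ≤ n ^ α := by positivity
            nlinarith [sq_nonneg (n ^ α - R ω ^ 2), sq_nonneg (n ^ α), sq_nonneg (R ω ^ 2)]
      _ ≤ _ := by
          rw [lintegral_const_mul' _ _ ENNReal.ofReal_ne_top,
            lintegral_add_right' _ (hRm.pow_const 4).ennreal_ofReal]
          gcongr
          exact hM x
  refine ne_top_of_le_ne_top ?_ (lintegral_mono hb)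
  rw [lintegral_mul_const _ (by fun_prop)]
  refine ENNReal.mul_ne_top ?_ (by finiteness)
  exact (finite_integral_one_add_norm (E := ℝ) (r := 2) (by simp)).ne

section MarkLaw

variable {K : Compacts ℝ≥0}

theorem enorm_markMap_rpow {α : ℝ} (hα : 0 < α) {φ : ℝ → ℝ} (hφ : ∀ x, 0 < φ x)
    (p : ℝ × ℝ × C(ℝ × ℝ≥0, ℝ)) :
    ‖markMap K α φ p‖ₑ ^ α =
      ‖p.1‖ₑ ^ α * ((ENNReal.ofReal (φ p.2.1))⁻¹ * ‖sectionOn K p.2.2 p.2.1‖ₑ ^ α) := by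
  have h : ‖φ p.2.1 ^ (-1 / α)‖ₑ ^ α = (ENNReal.ofReal (φ p.2.1))⁻¹ := by
    have := hφ p.2.1
    rw [← ofReal_norm, Real.norm_of_nonneg (by positivity),
      ENNReal.ofReal_rpow_of_nonneg (by positivity) hα.le, ← Real.rpow_mul this.le,
      div_mul_cancel₀ _ hα.ne', Real.rpow_neg_one, ENNReal.ofReal_inv_of_pos this]
  rw [markMap, enorm_smul, enorm_mul, ENNReal.mul_rpow_of_nonneg _ _ hα.le,
    ENNReal.mul_rpow_of_nonneg _ _ hα.le, h, mul_assoc]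

variable [mC : MeasurableSpace C(ℝ × ℝ≥0, ℝ)] [MeasurableSpace C(K, ℝ)]
  [BorelSpace C(K, ℝ)]

/-- The α-th power of φ^(-1/α) is 1/φ, which cancels the density of X; the Gaussian factor splits
off and has all moments. -/
theorem lintegral_enorm_markMap_ne_top
    (hC : mC = MeasurableSpace.comap (fun u p => u p) MeasurableSpace.pi)
    {α : ℝ} (hα : 0 < α) {φ : ℝ → ℝ} (hφm : Measurable φ) (hφ : ∀ x, 0 < φ x)
    {Q : Measure C(ℝ × ℝ≥0, ℝ)} [SFinite Q]
    (hQ : ∫⁻ x, ∫⁻ u, ‖sectionOn K u x‖ₑ ^ α ∂Q ≠ ∞) :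
    ∫⁻ p, ‖markMap K α φ p‖ₑ ^ α ∂((gaussianReal 0 1).prod
      ((volume.withDensity fun x => ENNReal.ofReal (φ x)).prod Q)) ≠ ∞ := by
  have hs := measurable_sectionOn (K := K) hC
  have hsm : Measurable fun p : ℝ × C(ℝ × ℝ≥0, ℝ) => ‖sectionOn K p.2 p.1‖ₑ ^ α :=
    hs.enorm.pow_const α
  have hgauss : ∫⁻ x, ‖x‖ₑ ^ α ∂(gaussianReal 0 1) ≠ ∞ := by
    have h := (memLp_id_gaussianReal (μ := 0) (v := 1) α.toNNReal).eLpNorm_lt_top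
    have h0 : ((α.toNNReal : ℝ≥0) : ℝ≥0∞) ≠ 0 := by simpa using hα
    have h1 := lintegral_rpow_enorm_lt_top_of_eLpNorm_lt_top h0 ENNReal.coe_ne_top h
    simpa [hα.le] using h1.ne
  have hgm : Measurable fun p : ℝ × C(ℝ × ℝ≥0, ℝ) =>
      (ENNReal.ofReal (φ p.1))⁻¹ * ‖sectionOn K p.2 p.1‖ₑ ^ α :=
    (hφm.comp measurable_fst).ennreal_ofReal.inv.mul hsm
  have hg1 : Measurable fun x : ℝ => ‖x‖ₑ ^ α := measurable_enorm.pow_const α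
  have hprod := lintegral_prod_mul (μ := gaussianReal 0 1)
    (ν := (volume.withDensity fun x => ENNReal.ofReal (φ x)).prod Q)
    hg1.aemeasurable hgm.aemeasurable
  rw [lintegral_congr (enorm_markMap_rpow hα hφ), hprod]
  refine ENNReal.mul_ne_top hgauss ?_
  have hJ : Measurable fun x => ∫⁻ u, ‖sectionOn K u x‖ₑ ^ α ∂Q := hsm.lintegral_prod_right'
  have hin : ∀ x, ∫⁻ u, (ENNReal.ofReal (φ x))⁻¹ * ‖sectionOn K u x‖ₑ ^ α ∂Q =
      (ENNReal.ofReal (φ x))⁻¹ * ∫⁻ u, ‖sectionOn K u x‖ₑ ^ α ∂Q := fun x =>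
    lintegral_const_mul' _ _ (ENNReal.inv_ne_top.2 (by simpa using hφ x))
  have h1 := lintegral_prod (μ := volume.withDensity fun x => ENNReal.ofReal (φ x)) (ν := Q) _
    hgm.aemeasurable
  have h2 := lintegral_withDensity_eq_lintegral_mul volume hφm.ennreal_ofReal
    (hφm.ennreal_ofReal.inv.mul hJ)
  have h3 := lintegral_congr (μ := volume.withDensity fun x => ENNReal.ofReal (φ x)) hin
  refine ne_top_of_le_ne_top hQ ((h1.trans (h3.trans h2)).trans_le (lintegral_mono fun x => ?_))
  have hx : ENNReal.ofReal (φ x) ≠ 0 := by simpa using hφ x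
  change ENNReal.ofReal (φ x) * ((ENNReal.ofReal (φ x))⁻¹ * _) ≤ _
  rw [← mul_assoc, ENNReal.mul_inv_cancel hx ENNReal.ofReal_ne_top, one_mul]

theorem map_neg_map_markMap
    (hC : mC = MeasurableSpace.comap (fun u p => u p) MeasurableSpace.pi)
    {α : ℝ} {φ : ℝ → ℝ} (hφm : Measurable φ) {Q : Measure (ℝ × C(ℝ × ℝ≥0, ℝ))} [SFinite Q] :
    (((gaussianReal 0 1).prod Q).map (markMap K α φ)).map (fun v => -v) =
      ((gaussianReal 0 1).prod Q).map (markMap K α φ) := by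
  have hm := measurable_markMap (K := K) hC hφm α
  have hneg : (((gaussianReal 0 1).prod Q).map (Prod.map (fun x => -x) id)) =
      (gaussianReal 0 1).prod Q := by
    rw [← Measure.map_prod_map _ _ measurable_neg measurable_id, gaussianReal_map_neg, neg_zero,
      Measure.map_id]
  conv_rhs => rw [← hneg]
  rw [Measure.map_map measurable_neg hm, Measure.map_map hm (by fun_prop)]
  congr 1
  ext1 p
  simp [markMap]

end MarkLaw

/-! ### Independence of the marks and conclusion -/

/-- Mutual independence of four σ-algebras gives independence of each from the following ones. -/
theorem ProbabilityTheory.iIndep.indep_sup_of_fin_four {Ω : Type*} {mΩ : MeasurableSpace Ω}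
    {P : Measure Ω} {M : Fin 4 → MeasurableSpace Ω} (h : iIndep M P) (hle : ∀ i, M i ≤ mΩ) :
    Indep (M 0) (M 1 ⊔ (M 2 ⊔ M 3)) P ∧ Indep (M 1) (M 2 ⊔ M 3) P ∧ Indep (M 2) (M 3) P := by
  have hmem : ∀ (S : Set (Fin 4)) (i : Fin 4), i ∈ S → M i ≤ ⨆ j ∈ S, M j := fun S i hi =>
    le_iSup₂ (f := fun j (_ : j ∈ S) => M j) i hi
  have e0 := indep_iSup_of_disjoint hle h (S := {0}) (T := {1, 2, 3}) (by simp)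
  have e1 := indep_iSup_of_disjoint hle h (S := {1}) (T := {2, 3}) (by simp)
  have e2 := indep_iSup_of_disjoint hle h (S := {2}) (T := {3}) (by simp)
  refine ⟨?_, ?_, ?_⟩
  · exact indep_of_indep_of_le_left (indep_of_indep_of_le_right e0 (sup_le (hmem _ _ (by simp))
      (sup_le (hmem _ _ (by simp)) (hmem _ _ (by simp))))) (hmem _ _ (by simp))
  · exact indep_of_indep_of_le_left (indep_of_indep_of_le_right e1
      (sup_le (hmem _ _ (by simp)) (hmem _ _ (by simp)))) (hmem _ _ (by simp))
  · exact indep_of_indep_of_le_left (indep_of_indep_of_le_right e2 (hmem _ _ (by simp)))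
      (hmem _ _ (by simp))

/-- Each mark is `markMap` of (G n, X n, f n). Independence is built up from X and f, then G and (X,
f), then Γ and (G, X, f), which also identifies the law of a triple as a product. -/
theorem isSymmetricShot_shotMark
    {Ω : Type*} [MeasurableSpace Ω] {P : Measure Ω} [IsProbabilityMeasure P]
    {α : ℝ} (hα0 : 0 < α)
    {K : Compacts ℝ≥0} [MeasurableSpace C(K, ℝ)] [BorelSpace C(K, ℝ)]
    {φ : ℝ → ℝ} (hφm : Measurable φ) (hφpos : ∀ x, 0 < φ x)
    {Γ G X : ℕ → Ω → ℝ} {f : ℕ → Ω → C(ℝ × ℝ≥0, ℝ)}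
    (hΓ : IsUnitPoissonArrivalTimes Γ P)
    (hGm : ∀ n, Measurable (G n)) (hG : ∀ n, P.map (G n) = gaussianReal 0 1)
    (hGi : iIndepFun G P)
    (hXm : ∀ n, Measurable (X n))
    (hX : ∀ n, P.map (X n) = volume.withDensity fun x => ENNReal.ofReal (φ x))
    (hXi : iIndepFun X P)
    (hfm : ∀ n p, Measurable fun ω => f n ω p)
    (hfd : ∀ n, IdentDistrib (fun ω p => f n ω p) (fun ω p => f 0 ω p) P P)
    (hfi : iIndepFun (fun n ω p => f n ω p) P)
    (hf : ∫⁻ x, ∫⁻ ω, ‖sectionOn K (f 0 ω) x‖ₑ ^ α ∂P ≠ ∞)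
    (hind : iIndep
      ![MeasurableSpace.comap (fun ω n => Γ n ω) (inferInstance : MeasurableSpace (ℕ → ℝ)),
        MeasurableSpace.comap (fun ω n => G n ω) (inferInstance : MeasurableSpace (ℕ → ℝ)),
        MeasurableSpace.comap (fun ω n => X n ω) (inferInstance : MeasurableSpace (ℕ → ℝ)),
        MeasurableSpace.comap (fun ω n p => f n ω p)
          (inferInstance : MeasurableSpace (ℕ → ℝ × ℝ≥0 → ℝ))] P) :
    IsSymmetricShot α Γ (shotMark K α φ G X f) P := by
  let mC : MeasurableSpace C(ℝ × ℝ≥0, ℝ) :=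
    MeasurableSpace.comap (fun u p => u p) MeasurableSpace.pi
  have hC : mC = MeasurableSpace.comap (fun u p => u p) MeasurableSpace.pi := rfl
  have hfC : ∀ n, Measurable (f n) := fun n => measurable_of_eq_comap_eval hC (hfm n)
  have hm := measurable_markMap (K := K) hC hφm α
  have hΓs : Measurable fun ω n => Γ n ω := measurable_pi_lambda _ hΓ.measurable
  have hGs : Measurable fun ω n => G n ω := measurable_pi_lambda _ hGm
  have hXs : Measurable fun ω n => X n ω := measurable_pi_lambda _ hXm
  have hfs : Measurable fun ω n p => f n ω p :=
    measurable_pi_lambda _ fun n => measurable_pi_lambda _ (hfm n)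
  have hfcomap : MeasurableSpace.comap (fun ω n => f n ω) MeasurableSpace.pi ≤
      MeasurableSpace.comap (fun ω n p => f n ω p) MeasurableSpace.pi := by
    refine Measurable.comap_le
      (m₁ := MeasurableSpace.comap (fun ω n p => f n ω p) MeasurableSpace.pi) ?_
    refine @measurable_pi_lambda _ _ _ (_) _ _ fun n => ?_
    refine measurable_comap_iff.2 ?_
    exact (measurable_pi_apply n).comp (comap_measurable fun ω n p => f n ω p)
  obtain ⟨i0, i1, i2⟩ := hind.indep_sup_of_fin_four (Fin.forall_fin_succ.2 ⟨hΓs.comap_le,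
    Fin.forall_fin_succ.2 ⟨hGs.comap_le, Fin.forall_fin_succ.2 ⟨hXs.comap_le,
      Fin.forall_fin_succ.2 ⟨hfs.comap_le, fun i => i.elim0⟩⟩⟩⟩)
  have hXf : IndepFun (fun ω n => X n ω) (fun ω n => f n ω) P :=
    (IndepFun_iff_Indep _ _ _).2 (indep_of_indep_of_le_right i2 hfcomap)
  have hGXf : IndepFun (fun ω n => G n ω) (fun ω n => (X n ω, f n ω)) P := by
    have h1 : IndepFun (fun ω n => G n ω) (fun ω => ((fun n => X n ω), fun n => f n ω)) P := by
      refine (IndepFun_iff_Indep _ _ _).2 (indep_of_indep_of_le_right i1 ?_)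
      exact (MeasurableSpace.comap_prodMk _ _).le.trans (sup_le_sup le_rfl hfcomap)
    exact h1.comp measurable_id (ψ := fun p n => (p.1 n, p.2 n)) (by fun_prop)
  have hΓV : IndepFun (fun ω n => Γ n ω) (fun ω n => shotMark K α φ G X f n ω) P := by
    have h1 : IndepFun (fun ω n => Γ n ω)
        (fun ω => ((fun n => G n ω), (fun n => X n ω), fun n => f n ω)) P := by
      refine (IndepFun_iff_Indep _ _ _).2 (indep_of_indep_of_le_right i0 ?_)
      exact (MeasurableSpace.comap_prodMk _ _).le.trans (sup_le_sup le_rfl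
        ((MeasurableSpace.comap_prodMk _ _).le.trans (sup_le_sup le_rfl hfcomap)))
    have h2 := h1.comp measurable_id (ψ := fun p n => markMap K α φ (p.1 n, p.2.1 n, p.2.2 n))
      (measurable_pi_lambda _ fun n => hm.comp (by fun_prop))
    exact h2
  have hfiC : iIndepFun f P := by
    refine (iIndepFun_iff_iIndep _ _ _).2 ?_
    have h := (iIndepFun_iff_iIndep _ _ _).1 hfi
    convert h using 2 with n
    rw [hC, MeasurableSpace.comap_comp]
    rfl
  have hXfi := hXi.prodMk_of_indepFun hXm hfC hfiC hXf
  have hXfm : ∀ n, Measurable fun ω => (X n ω, f n ω) := fun n => (hXm n).prodMk (hfC n)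
  have hi := hGi.prodMk_of_indepFun hGm hXfm hXfi hGXf
  have hlawf : ∀ n, P.map (f n) = P.map (f 0) := by
    intro n
    ext s hs
    obtain ⟨t, ht, rfl⟩ := hs
    rw [Measure.map_apply (hfC n) ⟨t, ht, rfl⟩, Measure.map_apply (hfC 0) ⟨t, ht, rfl⟩]
    exact (hfd n).measure_mem_eq ht
  have hprobf : IsProbabilityMeasure (P.map (f 0)) :=
    Measure.isProbabilityMeasure_map (hfC 0).aemeasurable
  have hXlaw : IsProbabilityMeasure (volume.withDensity fun x => ENNReal.ofReal (φ x)) := by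
    rw [← hX 0]
    exact Measure.isProbabilityMeasure_map (hXm 0).aemeasurable
  have hlaw : ∀ n, P.map (shotMark K α φ G X f n) = ((gaussianReal 0 1).prod
      ((volume.withDensity fun x => ENNReal.ofReal (φ x)).prod (P.map (f 0)))).map
        (markMap K α φ) := by
    intro n
    have h1 := (indepFun_iff_map_prod_eq_prod_map_map (hXm n).aemeasurable
      (hfC n).aemeasurable).1 (hXf.comp (measurable_pi_apply n) (measurable_pi_apply n))
    have h2 := (indepFun_iff_map_prod_eq_prod_map_map (hGm n).aemeasurable
      (hXfm n).aemeasurable).1 (hGXf.comp (measurable_pi_apply n) (measurable_pi_apply n))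
    rw [h1, hG, hX, hlawf] at h2
    rw [← h2, Measure.map_map hm ((hGm n).prodMk (hXfm n))]
    rfl
  refine ⟨hΓ, fun n => hm.comp ((hGm n).prodMk (hXfm n)), hi.comp (fun _ => markMap K α φ)
    fun _ => hm, fun n => (hlaw n).trans (hlaw 0).symm, ?_, hΓV, ?_⟩
  · rw [hlaw 0]
    exact map_neg_map_markMap hC hφm
  · rw [hlaw 0, lintegral_map (by fun_prop) hm]
    refine lintegral_enorm_markMap_ne_top hC hα0 hφm hφpos ?_
    convert hf using 2 with x
    ext1 x
    have hs : Measurable fun u => ‖sectionOn K u x‖ₑ ^ α :=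
      ((measurable_sectionOn (K := K) hC).comp measurable_prodMk_left).enorm.pow_const α
    exact lintegral_map hs (hfC 0)

theorem mainTheorem10
    {Ω : Type*} [MeasurableSpace Ω] (P : Measure Ω) [IsProbabilityMeasure P]
    (α : ℝ) (hα0 : 0 < α) (hα2 : α < 2)
    (K : Compacts ℝ≥0) [MeasurableSpace C(K, ℝ)] [BorelSpace C(K, ℝ)]
    -- the positive density `φ`, and the sequences of random variables and random functions
    (φ : ℝ → ℝ) (hφm : Measurable φ) (hφpos : ∀ x, 0 < φ x)
    (Γ G X : ℕ → Ω → ℝ) (f : ℕ → Ω → C(ℝ × ℝ≥0, ℝ))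
    (hΓ : IsUnitPoissonArrivalTimes Γ P)
    -- `G n` i.i.d. standard normal
    (hGm : ∀ n, Measurable (G n)) (hG : ∀ n, P.map (G n) = gaussianReal 0 1)
    (hGi : iIndepFun G P)
    -- `X n` i.i.d. with density `φ`
    (hXm : ∀ n, Measurable (X n))
    (hX : ∀ n, P.map (X n) = volume.withDensity fun x => ENNReal.ofReal (φ x))
    (hXi : iIndepFun X P)
    -- `f n` independent copies of a nonnegative continuous random function
    (hfm : ∀ n p, Measurable fun ω => f n ω p)
    (hfd : ∀ n, IdentDistrib (fun ω p => f n ω p) (fun ω p => f 0 ω p) P P)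
    (hfi : iIndepFun (fun n ω p => f n ω p) P)
    (hf0 : ∀ n ω p, 0 ≤ f n ω p)
    -- moments of `‖f n (x, ·)‖_K` bounded uniformly in `x`
    (hfK : ∀ q : ℝ, 0 < q → ∃ M : ℝ≥0, ∀ n x, ∫⁻ ω, ‖sectionOn K (f n ω) x‖ₑ ^ q ∂P ≤ M)
    -- support condition, relative to fractional Brownian motions `B n`
    (H ρ : ℝ) (hρ : 0 ≤ ρ) (B : ℕ → ℝ≥0 → Ω → ℝ)
    (hB : ∀ n, IsFractionalBrownianMotion H (B n) P)
    (hsupp : ∀ n, ∀ᵐ ω ∂P, ∀ t : ℝ≥0,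
      Function.support (fun x => f n ω (x, t)) ⊆ enlargedRange (fun s => B n s ω) ρ t)
    -- the sequences `(Γ n)`, `(G n)`, `(X n)`, `(f n)` are mutually independent
    (hind : iIndep
      ![MeasurableSpace.comap (fun ω n => Γ n ω) (inferInstance : MeasurableSpace (ℕ → ℝ)),
        MeasurableSpace.comap (fun ω n => G n ω) (inferInstance : MeasurableSpace (ℕ → ℝ)),
        MeasurableSpace.comap (fun ω n => X n ω) (inferInstance : MeasurableSpace (ℕ → ℝ)),
        MeasurableSpace.comap (fun ω n p => f n ω p)
          (inferInstance : MeasurableSpace (ℕ → ℝ × ℝ≥0 → ℝ))] P)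
    (y' : StrongDual ℝ C(K, ℝ)) :
    let V : ℕ → Ω → C(K, ℝ) := shotMark K α φ G X f
    let ν : Measure (ℝ × C(K, ℝ)) := (volume.restrict (Set.Ioi 0)).prod (P.map (V 0))
    let Φ : ℂ := Complex.exp (∫ p, levyKhintchineIntegrand y' (shotKernel α p.1 p.2) ∂ν)
    -- the integral in the exponent converges absolutely
    Integrable (fun p : ℝ × C(K, ℝ) => levyKhintchineIntegrand y' (shotKernel α p.1 p.2)) ν ∧
    -- the formula for `Y_φ` as a random element of `C(K)`
    (∀ Y : Ω → C(K, ℝ), IsShotSeries α Γ V Y P →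
      ∫ ω, Complex.exp (Complex.I * (y' (Y ω) : ℂ)) ∂P = Φ) ∧
    -- the formula for `⟨y', Y_φ⟩` as the almost sure sum of the series `∑ ⟨y', h (Γ n, V n)⟩`
    (∃ Z : Ω → ℝ, Measurable Z ∧
      (∀ᵐ ω ∂P, Tendsto (fun N => y' (shotPartialSum α Γ V N ω)) atTop (𝓝 (Z ω))) ∧
      ∫ ω, Complex.exp (Complex.I * (Z ω : ℂ)) ∂P = Φ) := by
  intro V ν Φ
  obtain ⟨T, hT⟩ : ∃ T : ℝ≥0, ∀ t ∈ K, t ≤ T := K.isCompact.bddAbove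
  -- Index 0 is enough, since the marks share one law.
  obtain ⟨-, -, hBG, hB0, -, hBc⟩ := hB 0
  obtain ⟨R, hRm, hR, hBR⟩ := hBG.exists_ae_mem_enlargedRange hB0 hBc T hρ
  -- The order 2α comes from the term a² in the bound a R² ≤ a² + R⁴, where a is an α-th power of a
  -- norm.
  obtain ⟨M, hM⟩ := hfK (2 * α) (by positivity)
  have hf := lintegral_lintegral_sectionOn_ne_top hα0 hT hRm hR (by
    filter_upwards [hBR, hsupp 0] with ω h1 h2 t ht x hx
    exact h1 t ht x (h2 t hx)) (hM 0)
  have h : IsSymmetricShot α Γ V P := isSymmetricShot_shotMark hα0 hφm hφpos hΓ hGm hG hGi hXm hX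
    hXi hfm hfd hfi hf hind
  have hlim := h.tendsto_integral_exp hα0 hα2 y'
  have hSm : ∀ N, Measurable fun ω => y' (shotPartialSum α Γ V N ω) := by
    intro N
    refine y'.continuous.measurable.comp (Finset.measurable_sum _ fun n _ => ?_)
    exact (measurable_shotKernel α).comp ((h.arrival.measurable n).prodMk (h.measurable n))
  refine ⟨?_, fun Y hY => ?_, ?_⟩
  · have : IsProbabilityMeasure (P.map (V 0)) :=
      Measure.isProbabilityMeasure_map (h.measurable 0).aemeasurable
    exact integrable_levyKhintchineIntegrand_shotKernel hα0 hα2 h.moment y'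
  · obtain ⟨ns, hns, hY'⟩ := h.tendsto_subseq_integral_exp hY y'
    exact tendsto_nhds_unique hY' (hlim.comp hns.tendsto_atTop)
  · obtain ⟨Z, hZm, hZ⟩ := measurable_limit_of_tendsto_metrizable_ae
      (fun N => (hSm N).aemeasurable) (h.ae_exists_tendsto hα0 hα2 y')
    refine ⟨Z, hZm, hZ, tendsto_nhds_unique ?_ hlim⟩
    refine tendsto_integral_of_dominated_convergence (fun _ => 1)
      (fun N => Measurable.aestronglyMeasurable ?_) (integrable_const _)
      (fun N => ae_of_all _ fun ω => (norm_exp_I_mul_ofReal _).le) ?_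
    · exact Complex.measurable_exp.comp ((Complex.measurable_ofReal.comp (hSm N)).const_mul _)
    · filter_upwards [hZ] with ω hω
      have hc : Continuous fun z : ℝ => Complex.exp (Complex.I * (z : ℂ)) := by fun_prop
      exact (hc.tendsto _).comp hω
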